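/- Let $\mathbb{T}\subset\mathbb{C}$ be the unit circle with normalized arc length measure $\tau$, and let $\hat f(k)=\frac{1}{2\pi i}\int_{\mathbb{T}}f(z)\,\bar z^{\,k+1}\,dz$, $k\in\mathbb{Z}$. Derivatives on $\mathbb{T}$ are taken along the circle, $f'(z)=\lim_{w\to z,\;w\in\mathbb{T}\setminus\{z\}}\frac{f(w)-f(z)}{w-z}$; $D^n(\mathbb{T})$ and $C^n(\mathbb{T})$ denote the sets of $n$ times differentiable, respectively $n$ times continuously differentiable, functions $f:\mathbb{T}\to\mathbb{C}$ in this sense. For $m\ge 0$ let $\mathcal{F}_m(\mathbb{T})$ be the set of all $f\in C^m(\mathbb{T})$ with $f(z)=\sum_{k\in\mathbb{Z}}\hat f(k)z^k$ for all $z\in\mathbb{T}$ and $\sum_{k\in\mathbb{Z}}|k|^m|\hat f(k)|<\infty$ (with $0^0=1$). For $f\in D^n(\mathbb{T})$ the divided differences are defined by $f^{[0]}=f$ and, for $1\le k\le n$ and $z_0,\dots,z_k\in\mathbb{T}$, $$f^{[k]}(z_0,\dots,z_k)=\begin{cases}\dfrac{f^{[k-1]}(z_0,z_2,\dots,z_k)-f^{[k-1]}(z_1,z_2,\dots,z_k)}{z_0-z_1},&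 z_0\ne z_1,\\[2mm] \dfrac{\partial}{\partial z_1}f^{[k-1]}(z_1,z_2,\dots,z_k),& z_0=z_1.\end{cases}$$ For $n\ge 1$ let $\mathfrak{F}_n$ be the set of all $f\in D^n(\mathbb{T})$ such that $f^{(n)}$ is bounded and $$f^{[n]}(z_0,\dots,z_n)=\int_\Omega a_0(z_0,\omega)\cdots a_n(z_n,\omega)\,d\nu(\omega)\qquad\text{for all }z_0,\dots,z_n\in\mathbb{T}$$ for some $\sigma$-finite measure space $(\Omega,\nu)$ and some bounded measurable functions $a_i:\mathbb{T}\times\Omega\to\mathbb{C}$ with $\int_\Omega\|a_0(\cdot,\omega)\|_\infty\cdots\|a_n(\cdot,\omega)\|_\infty\,d\nu(\omega)<\infty$, where $\|\cdot\|_\infty$ is the supremum norm on $\mathbb{T}$. Let $w\in C^\infty(\mathbb{R})$ satisfy $w\ge 0$, $\operatorname{supp}w\subset[\frac12,2]$ and $w(x)=1-w(x/2)$ for $x\in[1,2]$. Put $W_0(z)=\bar z+1+z$, $W_m(z)=\sum_{k\in\mathbb{Z}}w(k/2^m)z^k$ for $m\ge 1$, and $W_m^\sharp=\overline{W_m}$.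 With convolution taken with respect to $\tau$, the Besov class $B^n_{\infty,1}(\mathbb{T})$ consists of all integrable functions $\varphi$ on $\mathbb{T}$ with $$\sum_{m\ge 0}2^{nm}\|\varphi*W_m\|_\infty<\infty\quad\text{and}\quad\sum_{m\ge 1}2^{nm}\|\varphi*W_m^\sharp\|_\infty<\infty .$$ Functions in this class are understood up to equality $\tau$-almost everywhere. Then, for every integer $n\ge 1$: (i) $B^n_{\infty,1}(\mathbb{T})\subset\mathfrak{F}_n$; that is, every $\varphi\in B^n_{\infty,1}(\mathbb{T})$ coincides $\tau$-almost everywhere with a function in $\mathfrak{F}_n$, and every continuous $\varphi\in B^n_{\infty,1}(\mathbb{T})$ itself belongs to $\mathfrak{F}_n$; (ii) $\mathfrak{F}_n\subset\mathcal{F}_{n-1}(\mathbb{T})$; (iii) $\mathfrak{F}_n=\bigcap_{k=1}^n\mathfrak{F}_k$. -/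

import Mathlib

open MeasureTheory Filter Topology

noncomputable section

namespace CircleFunctionClasses

/-- The Borel sigma-algebra on the unit circle `𝕋`. -/
instance circleMeasurableSpace : MeasurableSpace Circle := borel Circle

instance circleBorelSpace : BorelSpace Circle := ⟨rfl⟩

/-- The normalized arc length measure `τ` on `𝕋`. -/
def arcMeasure : Measure Circle :=
  (ENNReal.ofReal (2 * Real.pi))⁻¹ •
    Measure.map (fun t : ℝ => Circle.exp t)
      (volume.restrict (Set.Ioc 0 (2 * Real.pi)))

/-- The supremum norm of a function on `𝕋`, with values in `[0, ∞]`. -/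
def supNorm (g : Circle → ℂ) : ENNReal := ⨆ z : Circle, ‖g z‖ₑ

/-! ### Differentiation along the circle -/

/-- `g` has the derivative `d` at `z`, in the sense that
`(g w - g z) / (w - z) → d` as `w → z`, `w ≠ z`, within the circle. -/
def HasCircleDerivAt (g : Circle → ℂ) (d : ℂ) (z : Circle) : Prop :=
  Tendsto (fun w : Circle => (g w - g z) / ((w : ℂ) - (z : ℂ))) (𝓝[≠] z) (𝓝 d)

/-- The derivative of `g` at `z` along the circle (used only where it exists). -/
def circleDeriv (g : Circle → ℂ) (z : Circle) : ℂ :=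
  limUnder (𝓝[≠] z) (fun w : Circle => (g w - g z) / ((w : ℂ) - (z : ℂ)))

/-- The `k`-th derivative along the circle. -/
def iterCircleDeriv (k : ℕ) (f : Circle → ℂ) : Circle → ℂ := circleDeriv^[k] f

/-- `D^n(𝕋)`: the functions that are `n` times differentiable on the circle. -/
def DiffClass (n : ℕ) : Set (Circle → ℂ) :=
  {f | ∀ k < n, ∀ z : Circle, ∃ d : ℂ, HasCircleDerivAt (iterCircleDeriv k f) d z}

/-- `C^n(𝕋)`: the functions that are `n` times continuously differentiable on the circle. -/
def ContDiffClass (n : ℕ) : Set (Circle → ℂ) :=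
  {f | f ∈ DiffClass n ∧ Continuous (iterCircleDeriv n f)}

/-! ### Fourier coefficients and the classes `𝓕_n(𝕋)` -/

/-- The `k`-th Fourier coefficient
`(1 / 2πi) ∫_𝕋 f(z) z̄^{k+1} dz`, which is `∫_𝕋 f(z) z^{-k} dτ(z)` since `dz = 2πi z dτ(z)`. -/
def fourierCoefficient (f : Circle → ℂ) (k : ℤ) : ℂ :=
  ∫ z : Circle, f z * (z : ℂ) ^ (-k) ∂arcMeasure

/-- `𝓕_n(𝕋)`: the functions `f(z) = ∑ f̂(k) z^k` in `C^n(𝕋)` with `∑ |k|^n |f̂(k)| < ∞`. -/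
def FClass (n : ℕ) : Set (Circle → ℂ) :=
  {f | f ∈ ContDiffClass n ∧
    (∀ z : Circle, HasSum (fun k : ℤ => fourierCoefficient f k * (z : ℂ) ^ k) (f z)) ∧
    Summable (fun k : ℤ => |(k : ℝ)| ^ n * ‖fourierCoefficient f k‖)}

/-! ### Divided differences and the new function class -/

open Classical in
/-- The divided difference `f^{[n]}(z_0, …, z_n)`, by the usual recursion:
for `z_0 ≠ z_1` it is
`(f^{[n-1]}(z_0, z_2, …, z_n) - f^{[n-1]}(z_1, z_2, …, z_n)) / (z_0 - z_1)`,
and for `z_0 = z_1` it is the derivative of `w ↦ f^{[n-1]}(w, z_2, …, z_n)` at `w = z_1`. -/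
def divDiff (f : Circle → ℂ) : (n : ℕ) → (Fin (n + 1) → Circle) → ℂ
  | 0, z => f (z 0)
  | n + 1, z =>
    let g : Circle → ℂ := fun w =>
      divDiff f n (Fin.cons (α := fun _ => Circle) w (fun i : Fin n => z i.succ.succ))
    if z 0 ≠ z 1 then (g (z 0) - g (z 1)) / ((z 0 : ℂ) - (z 1 : ℂ))
    else circleDeriv g (z 1)

/-- `F` admits a representation
`F(z_0, …, z_n) = ∫_Ω a_0(z_0, ω) ⋯ a_n(z_n, ω) dν(ω)` for all `z_0, …, z_n ∈ 𝕋`, where `ν` is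
a `σ`-finite measure, the `a_i` are bounded and (jointly) measurable, and
`∫_Ω ‖a_0(·, ω)‖_∞ ⋯ ‖a_n(·, ω)‖_∞ dν(ω) < ∞`. -/
def HasIntegralRepresentation (n : ℕ) (F : (Fin (n + 1) → Circle) → ℂ) : Prop :=
  ∃ (Ω : Type) (_ : MeasurableSpace Ω) (ν : Measure Ω) (a : Fin (n + 1) → Circle → Ω → ℂ),
    SigmaFinite ν ∧
    (∀ i, Measurable (Function.uncurry (a i))) ∧
    (∀ i, ∃ C : ℝ, ∀ z ω, ‖a i z ω‖ ≤ C) ∧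
    (∫⁻ ω, ∏ i, supNorm (fun z => a i z ω) ∂ν) < ⊤ ∧
    ∀ z : Fin (n + 1) → Circle, F z = ∫ ω, ∏ i, a i (z i) ω ∂ν

/-- The new class: all `f ∈ D^n(𝕋)` with `f^{(n)}` bounded such that the divided difference
`f^{[n]}` admits an integral representation with separated variables. -/
def NewClass (n : ℕ) : Set (Circle → ℂ) :=
  {f | f ∈ DiffClass n ∧ (∃ C : ℝ, ∀ z, ‖iterCircleDeriv n f z‖ ≤ C) ∧
    HasIntegralRepresentation n (divDiff f n)}

/-! ### The Besov class `B^n_{∞,1}(𝕋)` -/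

/-- The dyadic cutoff functions `w` admissible in the definition of the Besov class. -/
structure IsDyadicCutoff (w : ℝ → ℝ) : Prop where
  smooth : ContDiff ℝ ((⊤ : ℕ∞) : WithTop ℕ∞) w
  nonneg : ∀ x, 0 ≤ w x
  supp : tsupport w ⊆ Set.Icc (1 / 2) 2
  dyadic : ∀ x ∈ Set.Icc (1 : ℝ) 2, w x = 1 - w (x / 2)

/-- The trigonometric polynomials `W_m`: `W_0(z) = z̄ + 1 + z`, and
`W_m(z) = ∑_k w(k / 2^m) z^k` for `m ≥ 1` (a sum with finitely many nonzero terms). -/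
def dyadicPoly (w : ℝ → ℝ) (m : ℕ) (z : Circle) : ℂ :=
  if m = 0 then starRingEnd ℂ (z : ℂ) + 1 + (z : ℂ)
  else ∑' k : ℤ, (w ((k : ℝ) / 2 ^ m) : ℂ) * (z : ℂ) ^ k

/-- The trigonometric polynomials `W_m^♯`, the complex conjugates of `W_m`. -/
def dyadicPolySharp (w : ℝ → ℝ) (m : ℕ) (z : Circle) : ℂ :=
  starRingEnd ℂ (dyadicPoly w m z)

/-- Convolution on the circle with respect to normalized arc length:
`(φ * W)(z) = ∫_𝕋 φ(ζ) W(ζ⁻¹ z) dτ(ζ)`. -/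
def circleConv (φ W : Circle → ℂ) (z : Circle) : ℂ :=
  ∫ ζ : Circle, φ ζ * W (ζ⁻¹ * z) ∂arcMeasure

/-- The Besov class `B^n_{∞,1}(𝕋)`, as a set of integrable functions that is closed under
modification on null sets: the sequences `2^{nm} ‖φ * W_m‖_∞`, `m ≥ 0`, and
`2^{nm} ‖φ * W_m^♯‖_∞`, `m ≥ 1`, are summable. -/
def BesovClass (w : ℝ → ℝ) (n : ℕ) : Set (Circle → ℂ) :=
  {φ | Integrable φ arcMeasure ∧
    (∑' m : ℕ, supNorm (fun z => (2 : ℂ) ^ (n * m) * circleConv φ (dyadicPoly w m) z)) < ⊤ ∧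
    (∑' m : ℕ, supNorm (fun z =>
      (2 : ℂ) ^ (n * (m + 1)) * circleConv φ (dyadicPolySharp w (m + 1)) z)) < ⊤}

end CircleFunctionClasses

end

open MeasureTheory Filter Topology

namespace CircleFunctionClasses

/-! ### Functions with separated variables -/

/-! The integral representation is obtained as an absolutely convergent series of products of
one-variable functions (`SeparatedBound`), the measure being counting measure on the index set. The
divided differences of z^k are explicit: up to sign and a unimodular factor they are complete
homogeneous symmetric polynomials in the z_i, or in their inverses when k < 0. Expanding these into
monomials costs at most (|k| + 1)^n for f^[n], so every Fourier series with ∑ |c_k| (|k| + 1)^n < ∞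
lies in the class (`mem_newClass_of_summable`).

For (ii) and (iii) only the boundedness of the top derivative matters. If f^(n+1) is bounded,
integration by parts and Parseval put (|k| + 1)^(n+1) f̂(k) in ℓ², and pairing with (|k| + 1)^(-1) ∈
ℓ² gives ∑ (|k| + 1)^n |f̂(k)| < ∞. This yields membership in 𝓕_n and, by the criterion above, in
each lower class.

For (i), split φ into its dyadic blocks φ * W_m and φ * W_m^♯. The crude expansion is too expensive
here; what is needed is that the n-th divided difference of a block T of frequency about 2^m has
separated norm at most C_n 2^(nm) ‖T‖_∞. `separatedBound_block` proves this by induction on the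
number of variables: a de la Vallée Poussin type multiplier in the exponent of the first variable
separates the terms where that exponent is small (the rest of the frequency remains in the other
variables, and induction applies) from those where it may be large (the sum over exponents is a
bounded multiplier of T, `norm_ramp_multiplier_le`). Summing the blocks gives a continuous function
in the class with the Fourier coefficients of φ, and uniqueness of Fourier coefficients finishes the
proof. -/

/-- `F` is an absolutely convergent series of products of continuous functions of one variable
bounded by one, with `ℓ¹`-norm of the coefficients at most `C`. -/
def SeparatedBound (n : ℕ) (F : (Fin n → Circle) → ℂ) (C : ℝ) : Prop :=
  ∃ (ι : Type) (_ : Countable ι) (c : ι → ℂ) (a : ι → Fin n → Circle → ℂ),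
    (∀ i l, Continuous (a i l)) ∧ (∀ i l z, ‖a i l z‖ ≤ 1) ∧
    Summable (fun i => ‖c i‖) ∧ ∑' i, ‖c i‖ ≤ C ∧
    ∀ z, HasSum (fun i => c i * ∏ l, a i l (z l)) (F z)

namespace SeparatedBound

variable {n : ℕ} {F G : (Fin n → Circle) → ℂ} {C D : ℝ}

theorem norm_prod_le_one {ι : Type*} {s : Finset ι} {a : ι → ℂ} (h : ∀ i, ‖a i‖ ≤ 1) :
    ‖∏ i ∈ s, a i‖ ≤ 1 := by
  rw [norm_prod]
  exact Finset.prod_le_one (fun _ _ => norm_nonneg _) (fun i _ => h i)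

theorem mono (h : SeparatedBound n F C) (hCD : C ≤ D) : SeparatedBound n F D := by
  obtain ⟨ι, hι, c, a, h1, h2, h3, h4, h5⟩ := h
  exact ⟨ι, hι, c, a, h1, h2, h3, h4.trans hCD, h5⟩

theorem prod (a : Fin n → Circle → ℂ) (ha : ∀ l, Continuous (a l)) (hb : ∀ l z, ‖a l z‖ ≤ 1)
    (c : ℂ) : SeparatedBound n (fun z => c * ∏ l, a l (z l)) ‖c‖ := by
  refine ⟨Unit, inferInstance, fun _ => c, fun _ => a, fun _ => ha, fun _ => hb,
    (hasSum_fintype _).summable, by simp, fun z => ?_⟩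
  simp

theorem zero : SeparatedBound n (fun _ => 0) 0 := by
  refine ⟨Empty, inferInstance, Empty.elim, Empty.elim, fun i => i.elim, fun i => i.elim,
    (hasSum_fintype _).summable, by simp, fun z => ?_⟩
  simp

theorem smul (h : SeparatedBound n F C) (k : ℂ) :
    SeparatedBound n (fun z => k * F z) (‖k‖ * C) := by
  obtain ⟨ι, hι, c, a, h1, h2, h3, h4, h5⟩ := h
  refine ⟨ι, hι, fun i => k * c i, a, h1, h2, ?_, ?_, fun z => ?_⟩
  · simpa only [norm_mul] using h3.mul_left ‖k‖
  · simp only [norm_mul, tsum_mul_left]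
    gcongr
  · simpa only [mul_assoc] using (h5 z).mul_left k

theorem hasSum {κ : Type} [Countable κ] {f : κ → (Fin n → Circle) → ℂ} {B : κ → ℝ}
    (h : ∀ k, SeparatedBound n (f k) (B k)) (hB : Summable B)
    (hF : ∀ z, HasSum (fun k => f k z) (F z)) : SeparatedBound n F (∑' k, B k) := by
  choose ι hι c a h1 h2 h3 h4 h5 using h
  have hsum : Summable (fun p : (Σ k, ι k) => ‖c p.1 p.2‖) := by
    rw [summable_sigma_of_nonneg fun _ => norm_nonneg _]
    exact ⟨h3, Summable.of_nonneg_of_le (fun k => tsum_nonneg fun _ => norm_nonneg _) h4 hB⟩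
  refine ⟨Σ k, ι k, inferInstance, fun p => c p.1 p.2, fun p => a p.1 p.2,
    fun p => h1 p.1 p.2, fun p => h2 p.1 p.2, hsum, ?_, fun z => ?_⟩
  · rw [hsum.tsum_sigma' h3]
    exact Summable.tsum_le_tsum h4
      (Summable.of_nonneg_of_le (fun k => tsum_nonneg fun _ => norm_nonneg _) h4 hB) hB
  · have hs : Summable (fun p : (Σ k, ι k) => c p.1 p.2 * ∏ l, a p.1 p.2 l (z l)) := by
      refine Summable.of_norm_bounded hsum fun p => ?_
      rw [norm_mul]
      exact mul_le_of_le_one_right (norm_nonneg _) (norm_prod_le_one fun l => h2 _ _ _ _)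
    have := hs.hasSum.sigma (fun k => h5 k z)
    rw [(hF z).unique this]
    exact hs.hasSum

theorem add (hF : SeparatedBound n F C) (hG : SeparatedBound n G D) :
    SeparatedBound n (fun z => F z + G z) (C + D) := by
  have := SeparatedBound.hasSum (κ := Bool) (f := fun b => cond b F G) (B := fun b => cond b C D)
    (F := fun z => F z + G z) (by rintro (_ | _) <;> assumption) (hasSum_fintype _).summable
    (fun z => by
      have := hasSum_fintype (fun b : Bool => cond b F G z)
      simpa using this)
  simpa using this

theorem sum {κ : Type*} (s : Finset κ) {f : κ → (Fin n → Circle) → ℂ} {B : κ → ℝ}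
    (h : ∀ k ∈ s, SeparatedBound n (f k) (B k)) :
    SeparatedBound n (fun z => ∑ k ∈ s, f k z) (∑ k ∈ s, B k) := by
  classical
  induction s using Finset.induction_on with
  | empty => simpa using zero
  | insert k s hk ih =>
    simp only [Finset.sum_insert hk]
    exact (h k (Finset.mem_insert_self _ _)).add
      (ih fun j hj => h j (Finset.mem_insert_of_mem hj))

theorem norm_le (h : SeparatedBound n F C) (z : Fin n → Circle) : ‖F z‖ ≤ C := by
  obtain ⟨ι, hι, c, a, h1, h2, h3, h4, h5⟩ := h
  rw [← (h5 z).tsum_eq]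
  refine (tsum_of_norm_bounded h3.hasSum fun i => ?_).trans h4
  rw [norm_mul]
  exact mul_le_of_le_one_right (norm_nonneg _) (norm_prod_le_one fun l => h2 _ _ _)

theorem continuous (h : SeparatedBound n F C) : Continuous F := by
  obtain ⟨ι, hι, c, a, h1, h2, h3, h4, h5⟩ := h
  have : F = fun z => ∑' i, c i * ∏ l, a i l (z l) := funext fun z => (h5 z).tsum_eq.symm
  rw [this]
  refine continuous_tsum (fun i => ?_) h3 fun i z => ?_
  · have := h1 i
    fun_prop
  · rw [norm_mul]
    exact mul_le_of_le_one_right (norm_nonneg _) (norm_prod_le_one fun l => h2 _ _ _)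

theorem comp_inv (h : SeparatedBound n F C) :
    SeparatedBound n (fun z => F fun l => (z l)⁻¹) C := by
  obtain ⟨ι, hι, c, a, h1, h2, h3, h4, h5⟩ := h
  exact ⟨ι, hι, c, fun i l z => a i l z⁻¹, fun i l => (h1 i l).comp continuous_inv,
    fun i l z => h2 i l z⁻¹, h3, h4, fun z => h5 _⟩

theorem mul_prod (h : SeparatedBound n F C) (u : Circle → ℂ) (hu : Continuous u)
    (hu1 : ∀ z, ‖u z‖ ≤ 1) : SeparatedBound n (fun z : Fin n → Circle => (∏ l, u (z l)) * F z) C := by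
  obtain ⟨ι, hι, c, a, h1, h2, h3, h4, h5⟩ := h
  refine ⟨ι, hι, c, fun i l z => u z * a i l z, fun i l => hu.mul (h1 i l), fun i l z => ?_,
    h3, h4, fun z => ?_⟩
  · rw [norm_mul]
    exact mul_le_one₀ (hu1 z) (norm_nonneg _) (h2 i l z)
  · have := (h5 z).mul_left (∏ l, u (z l))
    simpa only [Finset.prod_mul_distrib, mul_left_comm] using this

theorem cons_mul (h : SeparatedBound n F C) {g : Circle → ℂ} (hg : Continuous g) {K : ℝ}
    (hK : ∀ z, ‖g z‖ ≤ K) :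
    SeparatedBound (n + 1) (fun z : Fin (n + 1) → Circle => g (z 0) * F (fun l => z l.succ)) (K * C) := by
  have hK0 : 0 ≤ K := (norm_nonneg _).trans (hK 1)
  -- The new factor is normalized to g / K and K is moved into the coefficients, so K = 0 is treated
  -- apart.
  rcases hK0.eq_or_lt with rfl | hKp
  · have : ∀ z, g z = 0 := fun z => by simpa using hK z
    simpa [this] using zero (n := n + 1)
  obtain ⟨ι, hι, c, a, h1, h2, h3, h4, h5⟩ := h
  refine ⟨ι, hι, fun i => K * c i, fun i => Fin.cons (α := fun _ => Circle → ℂ) (fun z => g z / K) (a i), fun i l => ?_,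
    fun i l => ?_, ?_, ?_, fun z => ?_⟩
  · refine Fin.cases ?_ (fun l => ?_) l
    · simpa using hg.div_const _
    · simpa using h1 i l
  · refine Fin.cases ?_ (fun l => ?_) l
    · intro z
      simpa [abs_of_pos hKp] using (div_le_one hKp).2 (hK z)
    · simpa using h2 i l
  · simpa only [norm_mul] using h3.mul_left _
  · simp only [norm_mul, tsum_mul_left, Complex.norm_real, Real.norm_of_nonneg hK0]
    gcongr
  · have hK' : (K : ℂ) ≠ 0 := by exact_mod_cast hKp.ne'
    have := (h5 fun l => z l.succ).mul_left (g (z 0))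
    suffices h : ∀ i, (K * c i * ∏ l, (Fin.cons (α := fun _ => Circle → ℂ) (fun z => g z / K)
        (a i) : Fin (n + 1) → Circle → ℂ) l (z l)) = g (z 0) * (c i * ∏ l, a i l (z l.succ)) by
      simpa only [h] using this
    intro i
    rw [Fin.prod_univ_succ]
    simp only [Fin.cons_zero, Fin.cons_succ]
    field_simp

theorem hasIntegralRepresentation {F : (Fin (n + 1) → Circle) → ℂ}
    (h : SeparatedBound (n + 1) F C) : HasIntegralRepresentation n F := by
  obtain ⟨ι, hι, c, a, h1, h2, h3, h4, h5⟩ := h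
  let _ : MeasurableSpace ι := ⊤
  have hd : DiscreteMeasurableSpace ι := ⟨fun _ => trivial⟩
  -- The coefficient is absorbed into the factor of index 0, so that counting measure needs no
  -- weight.
  let b : Fin (n + 1) → Circle → ι → ℂ := fun l (z : Circle) i => (if l = 0 then c i else 1) * a i l z
  have hprod : ∀ (z : Fin (n + 1) → Circle) i, ∏ l, b l (z l) i = c i * ∏ l, a i l (z l) := by
    intro z i
    simp only [b, Finset.prod_mul_distrib]
    simp
  refine ⟨ι, ⊤, Measure.count, b, ?_, fun l => ?_, fun l => ?_, ?_, fun z => ?_⟩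
  · infer_instance
  · exact measurable_from_prod_countable_left fun i =>
      ((continuous_const (y := if l = 0 then c i else 1)).mul (h1 i l)).measurable
  · refine ⟨max (∑' i, ‖c i‖) 1, fun z i => ?_⟩
    simp only [b, norm_mul]
    refine (mul_le_of_le_one_right (norm_nonneg _) (h2 _ _ _)).trans ?_
    split_ifs
    · exact (h3.le_tsum i fun _ _ => norm_nonneg _).trans (le_max_left _ _)
    · simp
  · rw [lintegral_count]
    refine lt_of_le_of_lt (ENNReal.tsum_le_tsum (g := fun i => ‖c i‖ₑ) fun i => ?_) ?_
    · calc ∏ l, supNorm (fun z => b l z i)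
          ≤ ∏ l : Fin (n + 1), (if l = 0 then ‖c i‖ₑ else 1) := by
            refine Finset.prod_le_prod' fun l _ => iSup_le fun z => ?_
            simp only [b, enorm_mul]
            have : ‖a i l z‖ₑ ≤ 1 := by
              rw [← ofReal_norm]
              exact ENNReal.ofReal_le_one.2 (h2 i l z)
            split_ifs
            · exact mul_le_of_le_one_right' this
            · simpa only [enorm_one, one_mul] using this
        _ = ‖c i‖ₑ := by simp
    · have := h3.tsum_ofReal_lt_top
      simpa only [ofReal_norm] using this
  · rw [← (h5 z).tsum_eq]
    simp only [hprod]
    rw [integral_countable]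
    · simp
    · refine integrable_count_iff.2 (Summable.of_norm_bounded (g := fun i => ‖c i‖) h3 fun i => ?_)
      rw [norm_norm, norm_mul]
      exact mul_le_of_le_one_right (norm_nonneg _) (norm_prod_le_one fun l => h2 _ _ _)

end SeparatedBound

/-! ### Complete homogeneous symmetric polynomials -/

/-- The complete homogeneous symmetric polynomial of degree `d` in the entries of a list. -/
def completeHomogeneous : List ℂ → ℕ → ℂ
  | _, 0 => 1
  | [], _ + 1 => 0
  | x :: l, d + 1 => completeHomogeneous l (d + 1) + x * completeHomogeneous (x :: l) d

@[simp] theorem completeHomogeneous_zero (l : List ℂ) : completeHomogeneous l 0 = 1 := by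
  cases l <;> simp [completeHomogeneous]

@[simp] theorem completeHomogeneous_nil_succ (d : ℕ) : completeHomogeneous [] (d + 1) = 0 := by
  simp [completeHomogeneous]

theorem completeHomogeneous_cons_succ (x : ℂ) (l : List ℂ) (d : ℕ) :
    completeHomogeneous (x :: l) (d + 1) =
      completeHomogeneous l (d + 1) + x * completeHomogeneous (x :: l) d := by
  simp [completeHomogeneous]

theorem completeHomogeneous_cons (x : ℂ) (l : List ℂ) (d : ℕ) :
    completeHomogeneous (x :: l) d =
      ∑ j ∈ Finset.range (d + 1), x ^ j * completeHomogeneous l (d - j) := by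
  induction d with
  | zero => simp
  | succ d ih =>
    rw [completeHomogeneous_cons_succ, ih, Finset.sum_range_succ' _ (d + 1), Finset.mul_sum,
      add_comm]
    simp [pow_succ', mul_assoc]

theorem completeHomogeneous_singleton (x : ℂ) (d : ℕ) : completeHomogeneous [x] d = x ^ d := by
  induction d with
  | zero => simp
  | succ d ih => rw [completeHomogeneous_cons_succ, ih]; simp [pow_succ']

theorem completeHomogeneous_swap (x y : ℂ) (l : List ℂ) (d : ℕ) :
    completeHomogeneous (x :: y :: l) d = completeHomogeneous (y :: x :: l) d := by
  induction d using Nat.strong_induction_on with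
  | _ d ih =>
    match d with
    | 0 => simp
    | 1 =>
      simp only [completeHomogeneous_cons_succ _ _ 0, completeHomogeneous_zero]
      ring
    | d + 2 =>
      have h1 := ih (d + 1) (by omega)
      have h2 := ih d (by omega)
      rw [completeHomogeneous_cons_succ x (y :: l) (d + 1),
        completeHomogeneous_cons_succ y (x :: l) (d + 1),
        completeHomogeneous_cons_succ y l (d + 1), completeHomogeneous_cons_succ x l (d + 1)]
      have e1 := completeHomogeneous_cons_succ x (y :: l) d
      have e2 := completeHomogeneous_cons_succ y (x :: l) d
      linear_combination -y * e1 + x * e2 + (x + y) * h1 - x * y * h2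

theorem completeHomogeneous_perm {l l' : List ℂ} (h : l.Perm l') :
    ∀ d, completeHomogeneous l d = completeHomogeneous l' d := by
  induction h with
  | nil => intro d; rfl
  | cons x _ ih => intro d; simp only [completeHomogeneous_cons, ih]
  | swap x y l => exact completeHomogeneous_swap y x l
  | trans _ _ ih1 ih2 => intro d; rw [ih1, ih2]

/-- This is the recursion of divided differences in disguise: it identifies the divided differences
of powers with complete homogeneous polynomials. -/
theorem completeHomogeneous_sub (x y : ℂ) (l : List ℂ) (d : ℕ) :
    (x - y) * completeHomogeneous (x :: y :: l) d =
      completeHomogeneous (x :: l) (d + 1) - completeHomogeneous (y :: l) (d + 1) := by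
  induction d with
  | zero =>
    simp only [completeHomogeneous_cons_succ _ _ 0, completeHomogeneous_zero]
    ring
  | succ d ih =>
    rw [completeHomogeneous_cons_succ x (y :: l), completeHomogeneous_cons_succ x l,
      completeHomogeneous_cons_succ y l (d + 1)]
    linear_combination x * ih

/-- The list of the coordinates of a point of the torus, as complex numbers. -/
def coordList {n : ℕ} (z : Fin n → Circle) : List ℂ := List.ofFn fun i => (z i : ℂ)

theorem coordList_cons {n : ℕ} (w : Circle) (z : Fin n → Circle) :
    coordList (Fin.cons (α := fun _ => Circle) w z : Fin (n + 1) → Circle) =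
      (w : ℂ) :: coordList z := by
  simp [coordList, List.ofFn_succ]

theorem coordList_succ {n : ℕ} (z : Fin (n + 1) → Circle) :
    coordList z = (z 0 : ℂ) :: coordList fun l => z l.succ := by
  simp [coordList, List.ofFn_succ]

theorem coordList_comp_perm {n : ℕ} (z : Fin n → Circle) (σ : Equiv.Perm (Fin n)) :
    (coordList (z ∘ σ)).Perm (coordList z) :=
  σ.ofFn_comp_perm fun i => (z i : ℂ)

/-- The bound counts monomials: there are at most (d + 1)^n of them, each a product of unimodular
functions. -/
theorem separatedBound_completeHomogeneous (n d : ℕ) :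
    SeparatedBound (n + 1) (fun z => completeHomogeneous (coordList z) d) ((d + 1 : ℝ) ^ n) := by
  induction n generalizing d with
  | zero =>
    have := SeparatedBound.prod (n := 1) (fun _ z => (z : ℂ) ^ d) (fun _ => by fun_prop)
      (fun _ z => by simp [Circle.norm_coe]) 1
    simpa [coordList, completeHomogeneous_singleton] using this
  | succ n ih =>
    have h : ∀ j ∈ Finset.range (d + 1), SeparatedBound (n + 2)
        (fun z => (z 0 : ℂ) ^ j * completeHomogeneous (coordList fun l => z l.succ) (d - j))
        ((d + 1 : ℝ) ^ n) := by
      intro j hj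
      refine ((ih (d - j)).cons_mul (g := fun z => (z : ℂ) ^ j) (K := 1) (by fun_prop)
        fun z => by simp [Circle.norm_coe]).mono ?_
      rw [one_mul]
      gcongr
      exact d.sub_le j
    have e : (fun z : Fin (n + 2) → Circle => completeHomogeneous (coordList z) d) = fun z =>
        ∑ j ∈ Finset.range (d + 1),
          (z 0 : ℂ) ^ j * completeHomogeneous (coordList fun l => z l.succ) (d - j) := by
      funext z
      rw [coordList_succ, completeHomogeneous_cons]
    rw [e]
    refine (SeparatedBound.sum _ h).mono (le_of_eq ?_)
    simp [pow_succ']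

/-! ### Systems of divided differences -/

/-- `D 0, …, D n` are continuous symmetric functions with `D 0 = f` that satisfy the recursion of
the divided differences of `f`. -/
structure IsDivDiffSystem (n : ℕ) (f : Circle → ℂ) (D : (j : ℕ) → (Fin (j + 1) → Circle) → ℂ) :
    Prop where
  zero : ∀ z, D 0 z = f (z 0)
  continuous : ∀ j ≤ n, Continuous (D j)
  perm : ∀ j ≤ n, ∀ z (σ : Equiv.Perm (Fin (j + 1))), D j (z ∘ σ) = D j z
  recursion : ∀ j < n, ∀ (w z : Circle) (r : Fin j → Circle),
    ((w : ℂ) - z) * D (j + 1) (Fin.cons (α := fun _ => Circle) w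
        (Fin.cons (α := fun _ => Circle) z r)) =
      D j (Fin.cons (α := fun _ => Circle) w r) - D j (Fin.cons (α := fun _ => Circle) z r)

/-- No point of the circle is isolated, so derivatives are unique and `circleDeriv`, being a
`limUnder`, takes the expected value. -/
theorem punctured_neBot (z : Circle) : (𝓝[≠] z).NeBot := by
  have h : Tendsto (fun t : ℝ => z * Circle.exp t) (𝓝[≠] 0) (𝓝[≠] z) := by
    refine tendsto_nhdsWithin_iff.2 ⟨?_, ?_⟩
    · have : Continuous fun t : ℝ => z * Circle.exp t := by fun_prop
      simpa using (this.tendsto 0).mono_left nhdsWithin_le_nhds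
    · filter_upwards [self_mem_nhdsWithin,
        nhdsWithin_le_nhds (Ioo_mem_nhds (neg_lt_zero.2 Real.pi_pos) Real.pi_pos)] with t ht htp hz
      have h1 : Circle.exp t = 1 := mul_eq_left.1 (Set.mem_singleton_iff.1 hz)
      have h2 := Circle.arg_exp htp.1 htp.2.le
      rw [h1] at h2
      exact ht (by simpa using h2.symm)
  exact h.neBot

theorem HasCircleDerivAt.const_mul {g : Circle → ℂ} {d : ℂ} {z : Circle}
    (h : HasCircleDerivAt g d z) (c : ℂ) : HasCircleDerivAt (fun w => c * g w) (c * d) z := by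
  refine (Tendsto.const_mul c h).congr fun w => ?_
  ring

theorem HasCircleDerivAt.circleDeriv_eq {g : Circle → ℂ} {d : ℂ} {z : Circle}
    (h : HasCircleDerivAt g d z) : circleDeriv g z = d :=
  haveI := punctured_neBot z
  h.limUnder_eq

theorem hasCircleDerivAt_of_factor {g q : Circle → ℂ} {z : Circle} (hq : ContinuousAt q z)
    (h : ∀ w, g w - g z = ((w : ℂ) - z) * q w) : HasCircleDerivAt g (q z) z := by
  refine (hq.tendsto.mono_left nhdsWithin_le_nhds).congr' ?_
  filter_upwards [self_mem_nhdsWithin] with w hw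
  have : (w : ℂ) - z ≠ 0 := sub_ne_zero.2 fun h => hw (Circle.ext h)
  rw [h, mul_div_cancel_left₀ _ this]

namespace IsDivDiffSystem

variable {n : ℕ} {f : Circle → ℂ} {D : (j : ℕ) → (Fin (j + 1) → Circle) → ℂ}

/-- Off the diagonal, divide the recursion by w - z. On the diagonal, the recursion exhibits D_(j+1)
as the difference quotient of D_j, and continuity of D_(j+1) gives its limit. -/
theorem divDiff_eq (h : IsDivDiffSystem n f D) : ∀ j ≤ n, divDiff f j = D j := by
  intro j
  induction j with
  | zero =>
    intro _
    funext z
    rw [h.zero, divDiff]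
  | succ j ih =>
    intro hj
    funext z
    have ih' := ih (by omega)
    obtain ⟨w, z', rfl⟩ : ∃ w z', z = Fin.cons (α := fun _ => Circle) w z' :=
      ⟨z 0, Fin.tail z, (Fin.cons_self_tail z).symm⟩
    obtain ⟨u, r, rfl⟩ : ∃ w r, z' = Fin.cons (α := fun _ => Circle) w r :=
      ⟨z' 0, Fin.tail z', (Fin.cons_self_tail z').symm⟩
    have hrec := h.recursion j (by omega)
    have h1 : (Fin.cons (α := fun _ => Circle) w (Fin.cons (α := fun _ => Circle) u r) :
      Fin (j + 2) → Circle) 1 = u := rfl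
    simp only [divDiff, ih', Fin.cons_zero, Fin.cons_succ, h1]
    split_ifs with hwu
    · have : (w : ℂ) - u ≠ 0 := sub_ne_zero.2 fun h => hwu (Circle.ext h)
      rw [← hrec, mul_div_cancel_left₀ _ this]
    · replace hwu : w = u := not_not.1 hwu
      subst hwu
      refine HasCircleDerivAt.circleDeriv_eq (hasCircleDerivAt_of_factor
        (q := fun v => D (j + 1) (Fin.cons (α := fun _ => Circle) v
          (Fin.cons (α := fun _ => Circle) w r))) ?_ fun v => (hrec v w r).symm)
      refine ((h.continuous (j + 1) hj).comp ?_).continuousAt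
      fun_prop

theorem sub_update (h : IsDivDiffSystem n f D) {j : ℕ} (hj : j < n) (t : Fin (j + 1) → Circle)
    (i : Fin (j + 1)) (w z : Circle) :
    D j (Function.update t i w) - D j (Function.update t i z) = ((w : ℂ) - z) *
      D (j + 1) (Fin.cons (α := fun _ => Circle) w (Fin.cons (α := fun _ => Circle) z
        (Fin.tail (t ∘ Equiv.swap 0 i)))) := by
  have key : ∀ u, D j (Function.update t i u) =
      D j (Fin.cons (α := fun _ => Circle) u (Fin.tail (t ∘ Equiv.swap 0 i))) := by
    intro u
    rw [← h.perm j hj.le _ (Equiv.swap 0 i)]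
    congr 1
    funext l
    refine Fin.cases ?_ (fun l => ?_) l
    · simp
    · by_cases hl : l.succ = i
      · subst hl
        have : (0 : Fin (j + 1)) ≠ l.succ := (Fin.succ_ne_zero l).symm
        simp [Fin.tail, Function.update_of_ne this]
      · have : Equiv.swap 0 i l.succ = l.succ :=
          Equiv.swap_apply_of_ne_of_ne (Fin.succ_ne_zero l) hl
        simp [Fin.tail, this, Function.update_of_ne hl]
  rw [key, key, h.recursion j hj]

/-- Replace the entries z by w one at a time. By symmetry every entry may be moved to the front, so
each replacement contributes w - z times a value of D_(j+1) that tends to its value at the diagonal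
point z. Iteration yields f^(j)(z) = j! D_j(z, …, z). -/
theorem hasCircleDerivAt_diagonal (h : IsDivDiffSystem n f D) {j : ℕ} (hj : j < n) (z : Circle) :
    HasCircleDerivAt (fun w => D j fun _ => w) ((j + 1 : ℂ) * D (j + 1) fun _ => z) z := by
  -- Here `t i w` has its first i entries equal to w and the others equal to z; `Q i w` is the
  -- quotient arising from the passage from `t i w` to `t (i + 1) w`.
  let t : ℕ → Circle → Fin (j + 1) → Circle := fun i w l => if (l : ℕ) < i then w else z
  let Q : ℕ → Circle → ℂ := fun i w => if hi : i < j + 1 then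
    D (j + 1) (Fin.cons (α := fun _ => Circle) w (Fin.cons (α := fun _ => Circle) z
        (Fin.tail (t i w ∘ Equiv.swap 0 ⟨i, hi⟩)))) else 0
  have hQz : ∀ i ∈ Finset.range (j + 1), Q i z = D (j + 1) fun _ => z := by
    intro i hi
    simp only [Q, dif_pos (Finset.mem_range.1 hi)]
    congr 1
    funext l
    refine Fin.cases rfl (fun l => Fin.cases rfl (fun l => ?_) l) l
    simp [t, Fin.tail]
  have hQc : ∀ i ∈ Finset.range (j + 1), Continuous (Q i) := by
    intro i hi
    simp only [Q, dif_pos (Finset.mem_range.1 hi)]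
    refine (h.continuous (j + 1) hj).comp ?_
    refine Continuous.finCons continuous_id (Continuous.finCons continuous_const ?_)
    refine continuous_pi fun l => ?_
    simp only [t, Fin.tail, Function.comp]
    split_ifs <;> fun_prop
  have := hasCircleDerivAt_of_factor (g := fun w => D j fun _ => w)
    (q := fun w => ∑ i ∈ Finset.range (j + 1), Q i w) (z := z)
    (continuous_finsetSum _ hQc).continuousAt ?_
  · rw [Finset.sum_congr rfl hQz] at this
    simpa using this
  · intro w
    have h0 : t 0 w = fun _ => z := by simp [t]
    have h1 : t (j + 1) w = fun _ => w := by
      funext l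
      simp [t, l.2]
    rw [← h0, ← h1, ← Finset.sum_range_sub (fun i => D j (t i w)), Finset.mul_sum]
    refine Finset.sum_congr rfl fun i hi => ?_
    have hi' := Finset.mem_range.1 hi
    simp only [Q, dif_pos hi']
    rw [← h.sub_update hj]
    congr 2
    · funext l
      by_cases hl : l = ⟨i, hi'⟩
      · subst hl; simp [t]
      · have : (l : ℕ) ≠ i := fun e => hl (Fin.ext e)
        rw [Function.update_of_ne hl]
        simp only [t]
        congr 1
        simp; omega
    · funext l
      by_cases hl : l = ⟨i, hi'⟩
      · subst hl; simp [t]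
      · rw [Function.update_of_ne hl]

theorem iterCircleDeriv_eq (h : IsDivDiffSystem n f D) : ∀ j ≤ n, ∀ z,
    iterCircleDeriv j f z = (j.factorial : ℂ) * D j fun _ => z := by
  intro j
  induction j with
  | zero => intro _ z; simp [iterCircleDeriv, h.zero]
  | succ j ih =>
    intro hj z
    have e : iterCircleDeriv j f = fun w => (j.factorial : ℂ) * D j fun _ => w :=
      funext (ih (by omega))
    rw [iterCircleDeriv, Function.iterate_succ_apply', ← iterCircleDeriv, e]
    have := (h.hasCircleDerivAt_diagonal (j := j) (by omega) z).const_mul (j.factorial : ℂ)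
    rw [this.circleDeriv_eq]
    push_cast [Nat.factorial_succ]
    ring

theorem mem_diffClass (h : IsDivDiffSystem n f D) : f ∈ DiffClass n := by
  intro k hk z
  have e : iterCircleDeriv k f = fun w => (k.factorial : ℂ) * D k fun _ => w :=
    funext (h.iterCircleDeriv_eq k hk.le)
  rw [e]
  exact ⟨_, (h.hasCircleDerivAt_diagonal hk z).const_mul _⟩

theorem mem_newClass (h : IsDivDiffSystem n f D) {C : ℝ} (hC : SeparatedBound (n + 1) (D n) C) :
    f ∈ NewClass n := by
  refine ⟨h.mem_diffClass, ⟨n.factorial * C, fun z => ?_⟩, ?_⟩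
  · rw [h.iterCircleDeriv_eq n le_rfl, norm_mul, Complex.norm_natCast]
    gcongr
    exact hC.norm_le _
  · rw [h.divDiff_eq n le_rfl]
    exact hC.hasIntegralRepresentation

theorem hasSum {κ : Type*} {f : κ → Circle → ℂ} {F : Circle → ℂ}
    {D : κ → (j : ℕ) → (Fin (j + 1) → Circle) → ℂ} {B : κ → ℝ}
    (h : ∀ k, IsDivDiffSystem n (f k) (D k)) (hB : Summable B)
    (hD : ∀ k, ∀ j ≤ n, ∀ z, ‖D k j z‖ ≤ B k) (hF : ∀ z, HasSum (fun k => f k z) (F z)) :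
    IsDivDiffSystem n F (fun j z => ∑' k, D k j z) := by
  have hs : ∀ j ≤ n, ∀ z, Summable fun k => D k j z := fun j hj z =>
    Summable.of_norm_bounded hB fun k => hD k j hj z
  refine ⟨fun z => ?_, fun j hj => ?_, fun j hj z σ => ?_, fun j hj w z r => ?_⟩
  · simp only [(h _).zero, (hF _).tsum_eq]
  · exact continuous_tsum (fun k => (h k).continuous j hj) hB fun k z => hD k j hj z
  · exact tsum_congr fun k => (h k).perm j hj z σ
  · rw [← tsum_mul_left, ← Summable.tsum_sub (hs j hj.le _) (hs j hj.le _)]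
    exact tsum_congr fun k => (h k).recursion j hj w z r

theorem const_mul (h : IsDivDiffSystem n f D) (c : ℂ) :
    IsDivDiffSystem n (fun z => c * f z) (fun j z => c * D j z) := by
  refine ⟨fun z => ?_, fun j hj => (h.continuous j hj).const_mul c, fun j hj z σ => ?_,
    fun j hj w z r => ?_⟩
  · rw [h.zero]
  · rw [h.perm j hj]
  · rw [← mul_sub, ← h.recursion j hj]
    ring

end IsDivDiffSystem

/-! ### Divided differences of monomials and of series of monomials -/

/-- The divided differences of `z ↦ z ^ k`, for an integer `k`. -/
noncomputable def monomialDivDiff : ℤ → (j : ℕ) → (Fin (j + 1) → Circle) → ℂ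
  | .ofNat p, j, z => if j ≤ p then completeHomogeneous (coordList z) (p - j) else 0
  | .negSucc q, j, z => (-1) ^ j *
      ((∏ i, (z i : ℂ)⁻¹) * completeHomogeneous (coordList fun i => (z i)⁻¹) q)

theorem monomialDivDiff_natCast (p j : ℕ) (z : Fin (j + 1) → Circle) :
    monomialDivDiff (p : ℤ) j z =
      if j ≤ p then completeHomogeneous (coordList z) (p - j) else 0 := rfl

theorem monomialDivDiff_negSucc (q j : ℕ) (z : Fin (j + 1) → Circle) :
    monomialDivDiff (Int.negSucc q) j z = (-1) ^ j *
      ((∏ i, (z i : ℂ)⁻¹) * completeHomogeneous (coordList fun i => (z i)⁻¹) q) := rfl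

theorem separatedBound_monomialDivDiff (k : ℤ) (j : ℕ) :
    SeparatedBound (j + 1) (monomialDivDiff k j) ((|(k : ℝ)| + 1) ^ j) := by
  match k with
  | .ofNat p =>
    simp only [Int.ofNat_eq_natCast]
    have e : monomialDivDiff (p : ℤ) j = fun z =>
        if j ≤ p then completeHomogeneous (coordList z) (p - j) else 0 := rfl
    rw [e]
    split_ifs with h
    · refine (separatedBound_completeHomogeneous j (p - j)).mono ?_
      have : ((p - j : ℕ) : ℝ) ≤ p := by exact_mod_cast Nat.sub_le p j
      simp only [Int.cast_natCast, Nat.abs_cast]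
      gcongr
    · exact SeparatedBound.zero.mono (by positivity)
  | .negSucc q =>
    have e : monomialDivDiff (Int.negSucc q) j = fun z => (-1) ^ j *
      ((∏ i, (z i : ℂ)⁻¹) * completeHomogeneous (coordList fun i => (z i)⁻¹) q) := rfl
    rw [e]
    have h := ((separatedBound_completeHomogeneous j q).comp_inv.mul_prod
      (fun z => (z : ℂ)⁻¹) (by
        have : (fun z : Circle => (z : ℂ)⁻¹) = fun z : Circle => ((z⁻¹ : Circle) : ℂ) := by
          funext z; simp
        rw [this]; fun_prop) (fun z => by simp [Circle.norm_coe])).smul ((-1) ^ j)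
    refine h.mono ?_
    have : |((Int.negSucc q : ℤ) : ℝ)| = q + 1 := by
      rw [Int.cast_negSucc, abs_neg, Nat.abs_cast]
      push_cast
      rfl
    rw [this]
    simp only [norm_pow, norm_neg, norm_one, one_pow, one_mul]
    gcongr
    linarith

theorem isDivDiffSystem_monomial (n : ℕ) (k : ℤ) :
    IsDivDiffSystem n (fun z => (z : ℂ) ^ k) (monomialDivDiff k) := by
  have hcont : ∀ j ≤ n, Continuous (monomialDivDiff k j) := fun j _ =>
    (separatedBound_monomialDivDiff k j).continuous
  have hinv : ∀ z : Circle, (z : ℂ)⁻¹ = ((z⁻¹ : Circle) : ℂ) := fun z => by simp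
  match k with
  | .ofNat p =>
    simp only [Int.ofNat_eq_natCast] at hcont ⊢
    refine ⟨fun z => ?_, hcont, fun j hj z σ => ?_, fun j hj w z r => ?_⟩
    · simp [monomialDivDiff_natCast, coordList, completeHomogeneous_singleton]
    · simp only [monomialDivDiff_natCast, completeHomogeneous_perm (coordList_comp_perm z σ)]
    · simp only [monomialDivDiff_natCast, coordList_cons]
      rcases lt_trichotomy p j with h | rfl | h
      · rw [if_neg (by omega), if_neg (by omega), if_neg (by omega)]
        simp
      · simp
      · obtain ⟨d, rfl⟩ : ∃ d, p = j + 1 + d := ⟨p - (j + 1), by omega⟩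
        rw [if_pos (by omega), if_pos (by omega), if_pos (by omega),
          show j + 1 + d - (j + 1) = d by omega, show j + 1 + d - j = d + 1 by omega,
          completeHomogeneous_sub]
  | .negSucc q =>
    refine ⟨fun z => ?_, hcont, fun j hj z σ => ?_, fun j hj w z r => ?_⟩
    · simp [monomialDivDiff_negSucc, coordList, completeHomogeneous_singleton, zpow_negSucc,
        pow_succ', mul_comm]
    · simp only [monomialDivDiff_negSucc]
      have h1 := completeHomogeneous_perm (coordList_comp_perm (fun i => (z i)⁻¹) σ) q
      have h2 := Equiv.prod_comp σ fun i => (z i : ℂ)⁻¹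
      simp only [Function.comp_def] at h1 h2 ⊢
      rw [h1, h2]
    · have hc : ∀ (m : ℕ) (u : Circle) (s : Fin m → Circle),
          (fun i => (Fin.cons (α := fun _ => Circle) u s i : Circle)⁻¹) =
            Fin.cons (α := fun _ => Circle) u⁻¹ fun i => (s i)⁻¹ := by
        intro m u s
        funext i
        refine Fin.cases rfl (fun i => rfl) i
      simp only [monomialDivDiff_negSucc, hc, coordList_cons, Fin.prod_univ_succ, Fin.cons_zero,
        Fin.cons_succ]
      have h1 := completeHomogeneous_sub (w⁻¹ : Circle) (z⁻¹ : Circle)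
        (coordList fun i => (r i)⁻¹) q
      have h2 := completeHomogeneous_cons_succ (w⁻¹ : Circle) (coordList fun i => (r i)⁻¹) q
      have h3 := completeHomogeneous_cons_succ (z⁻¹ : Circle) (coordList fun i => (r i)⁻¹) q
      rw [h2, h3] at h1
      have hw : ((w⁻¹ : Circle) : ℂ) = (w : ℂ)⁻¹ := (hinv w).symm
      have hz : ((z⁻¹ : Circle) : ℂ) = (z : ℂ)⁻¹ := (hinv z).symm
      rw [hw, hz] at h1 ⊢
      -- Inversion turns w - z into its negative divided by wz: this is the source of the sign
      -- (-1)^j and of the product of inverses.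
      have e : ((w : ℂ) - z) * ((w : ℂ)⁻¹ * (z : ℂ)⁻¹) = (z : ℂ)⁻¹ - (w : ℂ)⁻¹ := by
        field_simp [Circle.coe_ne_zero]
      generalize (∏ i, (r i : ℂ)⁻¹) = P at *
      generalize completeHomogeneous ((w : ℂ)⁻¹ :: (z : ℂ)⁻¹ :: _) q = A at *
      rw [pow_succ]
      linear_combination (-(-1) ^ j * P * A) * e + (-1) ^ j * P * h1

/-- The divided differences of a series of monomials are obtained termwise if the coefficients
are summable with weight `(|k| + 1) ^ n`. -/
theorem isDivDiffSystem_series {n : ℕ} {κ : Type*} (e : κ → ℤ) (c : κ → ℂ) {F : Circle → ℂ}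
    (hc : Summable fun k => ‖c k‖ * (|(e k : ℝ)| + 1) ^ n)
    (hF : ∀ z : Circle, HasSum (fun k => c k * (z : ℂ) ^ e k) (F z)) :
    IsDivDiffSystem n F fun j z => ∑' k, c k * monomialDivDiff (e k) j z := by
  refine IsDivDiffSystem.hasSum (fun k => (isDivDiffSystem_monomial n (e k)).const_mul (c k)) hc
    (fun k j hj z => ?_) hF
  rw [norm_mul]
  gcongr
  refine ((separatedBound_monomialDivDiff (e k) j).norm_le z).trans ?_
  exact pow_le_pow_right₀ (by linarith [abs_nonneg (e k : ℝ)]) hj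

theorem separatedBound_series {n j : ℕ} (hj : j ≤ n) {κ : Type} [Countable κ] (e : κ → ℤ)
    (c : κ → ℂ) (hc : Summable fun k => ‖c k‖ * (|(e k : ℝ)| + 1) ^ n) :
    SeparatedBound (j + 1) (fun z => ∑' k, c k * monomialDivDiff (e k) j z)
      (∑' k, ‖c k‖ * (|(e k : ℝ)| + 1) ^ n) := by
  have h : ∀ k, SeparatedBound (j + 1) (fun z => c k * monomialDivDiff (e k) j z)
      (‖c k‖ * (|(e k : ℝ)| + 1) ^ n) := fun k =>
    ((separatedBound_monomialDivDiff (e k) j).smul (c k)).mono (by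
      gcongr
      linarith [abs_nonneg (e k : ℝ)])
  refine SeparatedBound.hasSum h hc fun z => Summable.hasSum ?_
  exact Summable.of_norm_bounded hc fun k => (h k).norm_le z

/-- The crude criterion: each z^k is expanded into monomials separately. It suffices for the lower
classes in (iii), but not for Besov functions. -/
theorem mem_newClass_of_summable {n : ℕ} {F : Circle → ℂ} (c : ℤ → ℂ)
    (hc : Summable fun k => ‖c k‖ * (|(k : ℝ)| + 1) ^ n)
    (hF : ∀ z : Circle, HasSum (fun k => c k * (z : ℂ) ^ k) (F z)) : F ∈ NewClass n :=
  (isDivDiffSystem_series (fun k => k) c hc hF).mem_newClass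
    (separatedBound_series le_rfl (fun k => k) c hc)

/-! ### Arc length measure -/

theorem integral_arcMeasure {E : Type*} [NormedAddCommGroup E] [NormedSpace ℝ E]
    {f : Circle → E} (hf : AEStronglyMeasurable f arcMeasure) :
    ∫ z, f z ∂arcMeasure = (2 * Real.pi)⁻¹ • ∫ t in (0 : ℝ)..2 * Real.pi, f (Circle.exp t) := by
  have hpi : 0 < 2 * Real.pi := by positivity
  have hne : (ENNReal.ofReal (2 * Real.pi))⁻¹ ≠ 0 := ENNReal.inv_ne_zero.2 ENNReal.ofReal_ne_top
  have hf' : AEStronglyMeasurable f (Measure.map (fun t : ℝ => Circle.exp t)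
      (volume.restrict (Set.Ioc 0 (2 * Real.pi)))) :=
    hf.mono_ac (Measure.absolutelyContinuous_smul hne)
  rw [arcMeasure, integral_smul_measure,
    integral_map (by fun_prop) hf', intervalIntegral.integral_of_le hpi.le,
    ENNReal.toReal_inv, ENNReal.toReal_ofReal hpi.le]

instance isProbabilityMeasure_arcMeasure : IsProbabilityMeasure arcMeasure := by
  refine ⟨?_⟩
  have hpi : 0 < 2 * Real.pi := by positivity
  have : Measurable fun t : ℝ => Circle.exp t := by fun_prop
  rw [arcMeasure, Measure.smul_apply, Measure.map_apply this MeasurableSet.univ, Set.preimage_univ,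
    Measure.restrict_apply_univ, Real.volume_Ioc, sub_zero, smul_eq_mul]
  exact ENNReal.inv_mul_cancel (by simpa using hpi) ENNReal.ofReal_ne_top

theorem continuous_zpow_circle (k : ℤ) : Continuous fun z : Circle => (z : ℂ) ^ k := by
  have : (fun z : Circle => (z : ℂ) ^ k) = fun z : Circle => ((z ^ k : Circle) : ℂ) := by
    funext z; simp
  rw [this]
  exact continuous_subtype_val.comp (continuous_zpow k)

theorem norm_zpow_circle (z : Circle) (k : ℤ) : ‖(z : ℂ) ^ k‖ = 1 := by
  rw [norm_zpow, Circle.norm_coe, one_zpow]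

theorem integrable_of_continuous {f : Circle → ℂ} (hf : Continuous f) :
    Integrable f arcMeasure :=
  hf.integrable_of_hasCompactSupport (HasCompactSupport.of_compactSpace f)

theorem integral_zpow (k : ℤ) : ∫ z : Circle, (z : ℂ) ^ k ∂arcMeasure = if k = 0 then 1 else 0 := by
  split_ifs with hk
  · simp [hk]
  · rw [integral_arcMeasure (continuous_zpow_circle k).aestronglyMeasurable]
    have h1 : ∀ t : ℝ, ((Circle.exp t : Circle) : ℂ) ^ k = Complex.exp (k * Complex.I * t) := by
      intro t
      rw [Circle.coe_exp, ← Complex.exp_int_mul]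
      ring_nf
    have hk' : (k : ℂ) * Complex.I ≠ 0 := by simp [hk]
    simp only [h1]
    rw [integral_exp_mul_complex hk']
    have h2 : Complex.exp (k * Complex.I * ((2 * Real.pi : ℝ) : ℂ)) = 1 := by
      rw [Complex.exp_eq_one_iff]
      exact ⟨k, by push_cast; ring⟩
    rw [h2]
    simp

theorem integral_norm_sq_sum_zpow {κ : Type*} (s : Finset κ) (a : κ → ℤ)
    (ha : Set.InjOn a s) :
    ∫ z : Circle, ‖∑ i ∈ s, (z : ℂ) ^ a i‖ ^ 2 ∂arcMeasure = s.card := by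
  classical
  have h : ∀ z : Circle, ((‖∑ i ∈ s, (z : ℂ) ^ a i‖ ^ 2 : ℝ) : ℂ) =
      ∑ i ∈ s, ∑ j ∈ s, (z : ℂ) ^ (a i - a j) := by
    intro z
    rw [Complex.ofReal_pow, ← Complex.mul_conj', map_sum, Finset.sum_mul_sum]
    refine Finset.sum_congr rfl fun i _ => Finset.sum_congr rfl fun j _ => ?_
    rw [map_zpow₀, ← Circle.coe_inv_eq_conj, Circle.coe_inv, inv_zpow',
      ← zpow_add₀ (Circle.coe_ne_zero z), sub_eq_add_neg]
  have h2 : ((∫ z : Circle, ‖∑ i ∈ s, (z : ℂ) ^ a i‖ ^ 2 ∂arcMeasure : ℝ) : ℂ) = s.card := by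
    rw [← integral_complex_ofReal]
    simp only [h]
    have hi : ∀ k : ℤ, Integrable (fun z : Circle => (z : ℂ) ^ k) arcMeasure := fun k =>
      integrable_of_continuous (continuous_zpow_circle k)
    rw [integral_finsetSum _ fun i _ => integrable_finsetSum _ fun j _ => hi _]
    simp only [integral_finsetSum _ fun j _ => hi _, integral_zpow, sub_eq_zero]
    have : ∀ i ∈ s, (∑ j ∈ s, if a i = a j then (1 : ℂ) else 0) = 1 := by
      intro i hi
      rw [Finset.sum_eq_single i (fun j hj hji => if_neg fun e => hji (ha hj hi e.symm))
        (fun h => absurd hi h), if_pos rfl]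
    rw [Finset.sum_congr rfl this]
    simp
  exact_mod_cast h2

/-! ### A de la Vallée Poussin type multiplier -/

/-- The multiplier that vanishes for `x ≤ 0`, increases linearly on `[0, L]`, and equals one on
`[L, Q * L]`. -/
noncomputable def ramp (L Q : ℕ) (x : ℤ) : ℝ :=
  (((Finset.range L).filter fun l : ℕ => (L : ℤ) ≤ x + l ∧ x + l < (Q + 1) * L).card : ℝ) / L

theorem ramp_nonneg (L Q : ℕ) (x : ℤ) : 0 ≤ ramp L Q x := by unfold ramp; positivity

theorem ramp_le_one (L Q : ℕ) (x : ℤ) : ramp L Q x ≤ 1 := by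
  refine div_le_one_of_le₀ ?_ (by positivity)
  exact_mod_cast (Finset.card_filter_le _ _).trans (by simp)

theorem ramp_of_nonpos (L Q : ℕ) {x : ℤ} (hx : x ≤ 0) : ramp L Q x = 0 := by
  have : ((Finset.range L).filter fun l : ℕ => (L : ℤ) ≤ x + l ∧ x + l < (Q + 1) * L) = ∅ := by
    refine Finset.filter_eq_empty_iff.2 fun l hl h => ?_
    have := Finset.mem_range.1 hl
    omega
  simp [ramp, this]

theorem ramp_eq_one {L Q : ℕ} (hL : 0 < L) {x : ℤ} (h1 : L ≤ x) (h2 : x ≤ Q * L) :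
    ramp L Q x = 1 := by
  have : ((Finset.range L).filter fun l : ℕ => (L : ℤ) ≤ x + l ∧ x + l < (Q + 1) * L) =
      Finset.range L := by
    refine Finset.filter_true_of_mem fun l hl => ?_
    have := Finset.mem_range.1 hl
    refine ⟨by omega, ?_⟩
    rw [add_mul, one_mul]
    omega
  have hL' : (L : ℝ) ≠ 0 := by positivity
  simp [ramp, this, hL']

/-- As g lives on [e, N], the shifted sum may keep the same range; this lets N stay fixed when
coefficients are shifted repeatedly. -/
theorem sum_range_shift {M : Type*} [AddCommMonoid M] {g : ℕ → M} {N e : ℕ}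
    (h1 : ∀ d, N < d → g d = 0) (h2 : ∀ d < e, g d = 0) :
    ∑ d ∈ Finset.range (N + 1), g d = ∑ j ∈ Finset.range (N + 1), g (j + e) := by
  have a : ∑ d ∈ Finset.range (e + (N + 1)), g d = ∑ d ∈ Finset.range (N + 1), g d := by
    rw [add_comm e, Finset.sum_range_add, Finset.sum_eq_zero (s := Finset.range e), add_zero]
    exact fun j _ => h1 _ (by omega)
  have b : ∑ d ∈ Finset.range (e + (N + 1)), g d =
      ∑ j ∈ Finset.range (N + 1), g (j + e) := by
    rw [Finset.sum_range_add, Finset.sum_eq_zero (s := Finset.range e), zero_add]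
    · simp only [add_comm e]
    · exact fun j hj => h2 _ (Finset.mem_range.1 hj)
  rw [← a, b]

/-- Up to the unimodular factor z^e, the sum is P convolved with a kernel whose coefficients are
`ramp` shifted by e. That kernel is S E / L for two geometric sums S and E, so its L¹ norm is
controlled by L² norms. Terms of P with frequency below e drop out because `ramp` vanishes there. -/
theorem norm_ramp_multiplier_le {L Q N : ℕ} (hL : 0 < L) (e : ℕ) {c : ℕ → ℂ}
    (hc : ∀ d, N < d → c d = 0) {M : ℝ}
    (hM : ∀ z : Circle, ‖∑ d ∈ Finset.range (N + 1), c d * (z : ℂ) ^ d‖ ≤ M) (z : Circle) :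
    ‖∑ j ∈ Finset.range (N + 1), (ramp L Q j : ℂ) * c (j + e) * (z : ℂ) ^ j‖ ≤ (Q + 1) * M := by
  have hM0 : 0 ≤ M := (norm_nonneg _).trans (hM 1)
  let P : Circle → ℂ := fun u => ∑ d ∈ Finset.range (N + 1), c d * (u : ℂ) ^ d
  let S : Circle → ℂ := fun u => ∑ l ∈ Finset.range L, (u : ℂ) ^ (l : ℤ)
  let E : Circle → ℂ := fun u => ∑ s ∈ Finset.range (Q * L), (u : ℂ) ^ (-((s : ℤ) + L))
  have hcz := continuous_zpow_circle
  have hS : Continuous S := by fun_prop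
  have hE : Continuous E := by fun_prop
  have hS2 : ∫ u, ‖S u‖ ^ 2 ∂arcMeasure = L := by
    rw [integral_norm_sq_sum_zpow _ _ fun a _ b _ h => by exact_mod_cast h, Finset.card_range]
  have hE2 : ∫ u, ‖E u‖ ^ 2 ∂arcMeasure = Q * L := by
    rw [integral_norm_sq_sum_zpow _ _ fun a _ b _ h => by simpa using h, Finset.card_range]
    push_cast
    rfl
  -- the integral of the polynomial against the kernel
  have key : ∫ u : Circle, P (z * u) * (u : ℂ) ^ (-(e : ℤ)) * (S u * E u) ∂arcMeasure =
      L * ((z : ℂ) ^ e * ∑ j ∈ Finset.range (N + 1),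
        (ramp L Q j : ℂ) * c (j + e) * (z : ℂ) ^ j) := by
    have h1 : ∀ u : Circle, P (z * u) * (u : ℂ) ^ (-(e : ℤ)) * (S u * E u) =
        ∑ d ∈ Finset.range (N + 1), c d * (z : ℂ) ^ d * ∑ l ∈ Finset.range L,
          ∑ s ∈ Finset.range (Q * L), (u : ℂ) ^ ((d : ℤ) - e + l - (s + L)) := by
      intro u
      simp only [P, S, E]
      rw [Finset.sum_mul_sum, Finset.sum_mul, Finset.sum_mul]
      refine Finset.sum_congr rfl fun d _ => ?_
      rw [Finset.mul_sum, Finset.mul_sum]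
      refine Finset.sum_congr rfl fun l _ => ?_
      rw [Finset.mul_sum, Finset.mul_sum]
      refine Finset.sum_congr rfl fun s _ => ?_
      have hu := Circle.coe_ne_zero u
      rw [show (d : ℤ) - e + l - (s + L) = d + -e + (l + -(s + L)) by ring, zpow_add₀ hu,
        zpow_add₀ hu, zpow_add₀ hu, Circle.coe_mul, mul_pow]
      simp only [zpow_natCast]
      ring
    have hi : ∀ k : ℤ, Integrable (fun z : Circle => (z : ℂ) ^ k) arcMeasure := fun k =>
      integrable_of_continuous (hcz k)
    simp only [h1]
    rw [integral_finsetSum _ fun d _ => Integrable.const_mul (integrable_finsetSum _ fun l _ =>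
      integrable_finsetSum _ fun s _ => hi _) _]
    have h2 : ∀ d ∈ Finset.range (N + 1), ∫ u : Circle, c d * (z : ℂ) ^ d *
        ∑ l ∈ Finset.range L, ∑ s ∈ Finset.range (Q * L),
          (u : ℂ) ^ ((d : ℤ) - e + l - (s + L)) ∂arcMeasure =
        L * (ramp L Q ((d : ℤ) - e) * c d * (z : ℂ) ^ d) := by
      intro d _
      rw [integral_const_mul, integral_finsetSum _ fun l _ =>
        integrable_finsetSum _ fun s _ => hi _]
      have h3 : ∀ l ∈ Finset.range L, ∫ u : Circle, ∑ s ∈ Finset.range (Q * L),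
          (u : ℂ) ^ ((d : ℤ) - e + l - (s + L)) ∂arcMeasure =
          if (L : ℤ) ≤ (d : ℤ) - e + l ∧ (d : ℤ) - e + l < (Q + 1) * L then 1 else 0 := by
        intro l _
        rw [integral_finsetSum _ fun s _ => hi _]
        simp only [integral_zpow]
        split_ifs with h
        · obtain ⟨ha, hb⟩ := h
          rw [add_mul, one_mul] at hb
          rw [Finset.sum_eq_single ((d : ℤ) - e + l - L).toNat]
          · rw [if_pos (by omega)]
          · intro s _ hs
            rw [if_neg (by omega)]
          · intro hn
            exfalso
            apply hn
            rw [Finset.mem_range]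
            zify
            omega
        · refine Finset.sum_eq_zero fun s hs => if_neg fun h0 => h ?_
          have := Finset.mem_range.1 hs
          zify at this
          rw [add_mul, one_mul]
          constructor <;> omega
      rw [Finset.sum_congr rfl h3, Finset.sum_boole, ramp]
      have hL' : (L : ℂ) ≠ 0 := by exact_mod_cast hL.ne'
      push_cast
      field_simp
    rw [Finset.sum_congr rfl h2, ← Finset.mul_sum, sum_range_shift (e := e)]
    · congr 1
      rw [Finset.mul_sum]
      refine Finset.sum_congr rfl fun j _ => ?_
      push_cast
      rw [add_sub_cancel_right, pow_add]
      ring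
    · intro d hd
      rw [hc d hd]; ring
    · intro d hd
      rw [ramp_of_nonpos _ _ (by omega)]
      simp
  -- The bound |S E| ≤ |S|² + |E|² integrates to L + Q L; after division by L this is the constant Q
  -- + 1.
  have hle : ‖∫ u : Circle, P (z * u) * (u : ℂ) ^ (-(e : ℤ)) * (S u * E u) ∂arcMeasure‖ ≤
      ∫ u : Circle, M * (‖S u‖ ^ 2 + ‖E u‖ ^ 2) ∂arcMeasure := by
    refine norm_integral_le_of_norm_le ?_ (ae_of_all _ fun u => ?_)
    · refine Continuous.integrable_of_hasCompactSupport (by fun_prop)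
        (HasCompactSupport.of_compactSpace _)
    · rw [norm_mul, norm_mul, norm_zpow_circle, mul_one, norm_mul]
      have h1 : ‖P (z * u)‖ ≤ M := hM (z * u)
      have h2 : ‖S u‖ * ‖E u‖ ≤ ‖S u‖ ^ 2 + ‖E u‖ ^ 2 := by
        nlinarith [sq_nonneg (‖S u‖ - ‖E u‖), sq_nonneg ‖S u‖, sq_nonneg ‖E u‖]
      gcongr
  rw [key, integral_const_mul, integral_add, hS2, hE2, norm_mul, norm_mul, norm_pow,
    Circle.norm_coe, one_pow, one_mul, Complex.norm_natCast] at hle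
  · have hL' : (0 : ℝ) < L := by exact_mod_cast hL
    refine le_of_mul_le_mul_left (hle.trans (le_of_eq ?_)) hL'
    ring
  · exact Continuous.integrable_of_hasCompactSupport (by fun_prop)
      (HasCompactSupport.of_compactSpace _)
  · exact Continuous.integrable_of_hasCompactSupport (by fun_prop)
      (HasCompactSupport.of_compactSpace _)

/-! ### The separated bound for a dyadic block -/

theorem sum_completeHomogeneous_cons {N : ℕ} {c : ℕ → ℂ} (hc : ∀ d, N < d → c d = 0) (x : ℂ)
    (l : List ℂ) :
    ∑ d ∈ Finset.range (N + 1), c d * completeHomogeneous (x :: l) d =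
      ∑ j ∈ Finset.range (N + 1), x ^ j * ∑ e ∈ Finset.range (N + 1),
        c (e + j) * completeHomogeneous l e := by
  have h1 : ∀ d ∈ Finset.range (N + 1), c d * completeHomogeneous (x :: l) d =
      ∑ j ∈ Finset.range (N + 1),
        if j ≤ d then x ^ j * (c d * completeHomogeneous l (d - j)) else 0 := by
    intro d hd
    have hd' := Finset.mem_range.1 hd
    rw [completeHomogeneous_cons, Finset.mul_sum, ← Finset.sum_filter]
    have : (Finset.range (N + 1)).filter (fun j => j ≤ d) = Finset.range (d + 1) := by
      ext j; simp; omega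
    rw [this]
    exact Finset.sum_congr rfl fun j _ => by ring
  rw [Finset.sum_congr rfl h1, Finset.sum_comm]
  refine Finset.sum_congr rfl fun j _ => ?_
  rw [sum_range_shift (e := j), Finset.mul_sum]
  · exact Finset.sum_congr rfl fun e _ => by simp
  · intro d hd; simp [hc d hd]
  · intro d hd; rw [if_neg (by omega)]

/-- Write h_d(x, l) = ∑_j x^j h_(d-j)(l) and split the weight of x^j as (1 - ramp) + ramp. The first
part has only j < L; the shifted coefficients c_(e+j) give a polynomial of the same supremum norm
with no frequencies below n L, so induction applies. In the second part, for fixed e, the sum over j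
is a bounded multiplier of the polynomial, and h_e(l) costs at most (N + 1)^n. Each variable uses up
at most L frequencies, hence the hypothesis n L ≤ A. -/
theorem separatedBound_block {L Q : ℕ} (hL : 0 < L) (n : ℕ) : ∀ {N A : ℕ} {c : ℕ → ℂ} {M : ℝ},
    n * L ≤ A → N ≤ Q * L → (∀ d, N < d → c d = 0) → (∀ d < A, c d = 0) →
    (∀ z : Circle, ‖∑ d ∈ Finset.range (N + 1), c d * (z : ℂ) ^ d‖ ≤ M) →
    SeparatedBound (n + 1)
      (fun z => ∑ d ∈ Finset.range (N + 1), c d * completeHomogeneous (coordList z) d)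
      ((n * (Q + 1) + 1) * (N + 1) ^ n * M) := by
  induction n with
  | zero =>
    intro N A c M _ _ _ _ hM
    have := (SeparatedBound.prod (n := 0) (fun l _ => l.elim0) (fun l => l.elim0)
      (fun l => l.elim0) 1).cons_mul
      (g := fun z => ∑ d ∈ Finset.range (N + 1), c d * (z : ℂ) ^ d) (by fun_prop) hM
    simpa [coordList, completeHomogeneous_singleton] using this
  | succ n ih =>
    intro N A c M hA hN hc hcA hM
    have hM0 : 0 ≤ M := (norm_nonneg _).trans (hM 1)
    have hAL : L ≤ A := le_trans (by nlinarith) hA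
    have h1 : ∀ j ∈ Finset.range (N + 1), SeparatedBound (n + 2)
        (fun z => ((1 - ramp L Q j : ℝ) * (z 0 : ℂ) ^ j) * ∑ e ∈ Finset.range (N + 1),
          c (e + j) * completeHomogeneous (coordList fun l => z l.succ) e)
        ((n * (Q + 1) + 1) * (N + 1) ^ n * M) := by
      intro j hj
      have hj' := Finset.mem_range.1 hj
      rcases lt_or_ge j L with hjL | hjL
      · have := (ih (N := N) (A := A - j) (c := fun e => c (e + j)) (M := M)
          (by rw [add_mul] at hA; omega) hN (fun d hd => hc _ (by omega))
          (fun d hd => hcA _ (by omega)) (fun z => by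
            have h := hM z
            rw [sum_range_shift (e := j) (fun d hd => by rw [hc d hd]; ring)
              (fun d hd => by rw [hcA d (by omega)]; ring)] at h
            have e : ∑ i ∈ Finset.range (N + 1), c (i + j) * (z : ℂ) ^ (i + j) =
                (z : ℂ) ^ j * ∑ i ∈ Finset.range (N + 1), c (i + j) * (z : ℂ) ^ i := by
              rw [Finset.mul_sum]
              exact Finset.sum_congr rfl fun i _ => by ring
            rw [e, norm_mul, norm_pow, Circle.norm_coe, one_pow, one_mul] at h
            exact h)).cons_mul
          (g := fun z => (1 - ramp L Q j : ℝ) * (z : ℂ) ^ j) (K := 1) (by fun_prop) (fun z => by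
            rw [norm_mul, norm_pow, Circle.norm_coe, one_pow, mul_one, Complex.norm_real,
              Real.norm_of_nonneg (sub_nonneg.2 (ramp_le_one _ _ _))]
            linarith [ramp_nonneg L Q j])
        rwa [one_mul] at this
      -- The hypothesis N ≤ Q L enters here: no exponent lies beyond the plateau of the multiplier.
      · have hr : ramp L Q j = 1 := ramp_eq_one hL (by exact_mod_cast hjL) (by
          have : j ≤ Q * L := by omega
          exact_mod_cast this)
        simp only [hr, sub_self, Complex.ofReal_zero, zero_mul]
        exact SeparatedBound.zero.mono (by positivity)
    have h2 : ∀ e ∈ Finset.range (N + 1), SeparatedBound (n + 2)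
        (fun z => (∑ j ∈ Finset.range (N + 1), (ramp L Q j : ℂ) * c (j + e) * (z 0 : ℂ) ^ j) *
          completeHomogeneous (coordList fun l => z l.succ) e)
        ((Q + 1) * M * (N + 1) ^ n) := by
      intro e he
      have he' := Finset.mem_range.1 he
      refine ((separatedBound_completeHomogeneous n e).cons_mul
        (g := fun z => ∑ j ∈ Finset.range (N + 1), (ramp L Q j : ℂ) * c (j + e) * (z : ℂ) ^ j)
        (by fun_prop) (norm_ramp_multiplier_le hL e hc hM)).mono ?_
      have : (e : ℝ) ≤ N := by exact_mod_cast Nat.lt_succ_iff.1 he'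
      gcongr
    have e : (fun z : Fin (n + 2) → Circle =>
        ∑ d ∈ Finset.range (N + 1), c d * completeHomogeneous (coordList z) d) = fun z =>
        (∑ j ∈ Finset.range (N + 1), ((1 - ramp L Q j : ℝ) * (z 0 : ℂ) ^ j) *
          ∑ e ∈ Finset.range (N + 1),
            c (e + j) * completeHomogeneous (coordList fun l => z l.succ) e) +
        ∑ e ∈ Finset.range (N + 1),
          (∑ j ∈ Finset.range (N + 1), (ramp L Q j : ℂ) * c (j + e) * (z 0 : ℂ) ^ j) *
          completeHomogeneous (coordList fun l => z l.succ) e := by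
      funext z
      rw [coordList_succ, sum_completeHomogeneous_cons hc]
      simp only [Finset.mul_sum, Finset.sum_mul]
      rw [Finset.sum_comm (s := Finset.range (N + 1)) (t := Finset.range (N + 1))
        (f := fun e j => (ramp L Q j : ℂ) * c (j + e) * (z 0 : ℂ) ^ j *
          completeHomogeneous (coordList fun l => z l.succ) e), ← Finset.sum_add_distrib]
      refine Finset.sum_congr rfl fun j _ => ?_
      rw [← Finset.sum_add_distrib]
      refine Finset.sum_congr rfl fun i _ => ?_
      rw [add_comm j i]
      push_cast
      ring
    rw [e]
    refine ((SeparatedBound.sum _ h1).add (SeparatedBound.sum _ h2)).mono (le_of_eq ?_)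
    simp only [Finset.sum_const, Finset.card_range, nsmul_eq_mul]
    push_cast
    ring

/-! ### Calculus along the circle -/

theorem tendsto_exp_punctured (t : ℝ) :
    Tendsto (fun s : ℝ => Circle.exp s) (𝓝[≠] t) (𝓝[≠] Circle.exp t) := by
  refine tendsto_nhdsWithin_iff.2 ⟨?_, ?_⟩
  · have : Continuous fun s : ℝ => Circle.exp s := by fun_prop
    exact (this.tendsto t).mono_left nhdsWithin_le_nhds
  · filter_upwards [self_mem_nhdsWithin, nhdsWithin_le_nhds (Ioo_mem_nhds
      (show t - Real.pi < t by linarith [Real.pi_pos])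
      (show t < t + Real.pi by linarith [Real.pi_pos]))] with s hs hsp hz
    have h1 : Circle.exp (s - t) = 1 := by
      rw [Circle.exp_sub, Set.mem_singleton_iff.1 hz, div_self']
    have h2 := Circle.arg_exp (x := s - t) (by linarith [hsp.1]) (by linarith [hsp.2])
    rw [h1] at h2
    have h3 : s - t = 0 := by simpa using h2.symm
    exact hs (sub_eq_zero.1 h3)

theorem HasCircleDerivAt.continuousAt {g : Circle → ℂ} {d : ℂ} {z : Circle}
    (h : HasCircleDerivAt g d z) : ContinuousAt g z := by
  rw [continuousAt_iff_punctured_nhds]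
  have h1 : Tendsto (fun w : Circle => (w : ℂ) - z) (𝓝[≠] z) (𝓝 0) := by
    have : Continuous fun w : Circle => (w : ℂ) - z := by fun_prop
    simpa using (this.tendsto z).mono_left nhdsWithin_le_nhds
  have h2 := (Tendsto.mul h h1).const_add (g z)
  rw [mul_zero, add_zero] at h2
  refine h2.congr' ?_
  filter_upwards [self_mem_nhdsWithin] with w hw
  have : (w : ℂ) - z ≠ 0 := sub_ne_zero.2 fun h => hw (Circle.ext h)
  rw [div_mul_cancel₀ _ this]
  ring

theorem HasCircleDerivAt.hasDerivAt_comp_exp {g : Circle → ℂ} {d : ℂ} {t : ℝ}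
    (h : HasCircleDerivAt g d (Circle.exp t)) :
    HasDerivAt (fun s : ℝ => g (Circle.exp s)) (d * (Circle.exp t * Complex.I)) t := by
  have h0 : HasDerivAt (fun s : ℝ => ((Circle.exp s : Circle) : ℂ))
      (Circle.exp t * Complex.I) t := by
    have : HasDerivAt (fun s : ℝ => (s : ℂ) * Complex.I) (1 * Complex.I) t :=
      (Complex.ofRealCLM.hasDerivAt (x := t)).mul_const Complex.I
    simpa using this.cexp
  rw [hasDerivAt_iff_tendsto_slope] at h0 ⊢
  refine ((Tendsto.comp h (tendsto_exp_punctured t)).mul h0).congr' ?_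
  filter_upwards [(tendsto_exp_punctured t).eventually self_mem_nhdsWithin] with s hs
  have : ((Circle.exp s : Circle) : ℂ) - (Circle.exp t : Circle) ≠ 0 :=
    sub_ne_zero.2 fun h => hs (Circle.ext h)
  simp only [Function.comp, slope_def_module, Complex.real_smul]
  field_simp

theorem HasDerivAt.hasCircleDerivAt {g : ℂ → ℂ} {d : ℂ} {z : Circle} (h : HasDerivAt g d z) :
    HasCircleDerivAt (fun w => g w) d z := by
  rw [hasDerivAt_iff_tendsto_slope] at h
  have ht : Tendsto (fun w : Circle => (w : ℂ)) (𝓝[≠] z) (𝓝[≠] (z : ℂ)) := by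
    refine tendsto_nhdsWithin_iff.2 ⟨?_, ?_⟩
    · exact (continuous_subtype_val.tendsto z).mono_left nhdsWithin_le_nhds
    · filter_upwards [self_mem_nhdsWithin] with w hw hz
      exact hw (Circle.ext hz)
  refine (h.comp ht).congr fun w => ?_
  simp [slope_def_field]

theorem HasCircleDerivAt.mul {f g : Circle → ℂ} {d e : ℂ} {z : Circle}
    (hf : HasCircleDerivAt f d z) (hg : HasCircleDerivAt g e z) :
    HasCircleDerivAt (fun w => f w * g w) (d * g z + f z * e) z := by
  refine ((Tendsto.mul hf (hg.continuousAt.tendsto.mono_left nhdsWithin_le_nhds)).add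
    (Tendsto.const_mul (f z) hg)).congr fun w => ?_
  ring

theorem hasCircleDerivAt_circleDeriv {g : Circle → ℂ} {z : Circle}
    (h : ∃ d, HasCircleDerivAt g d z) : HasCircleDerivAt g (circleDeriv g z) z := by
  obtain ⟨d, hd⟩ := h
  rwa [hd.circleDeriv_eq]

theorem continuous_of_hasCircleDerivAt {g : Circle → ℂ}
    (h : ∀ z, ∃ d, HasCircleDerivAt g d z) : Continuous g :=
  continuous_iff_continuousAt.2 fun z => (h z).choose_spec.continuousAt

/-- The top derivative is merely bounded, not continuous; it is measurable as a pointwise limit of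
difference quotients along a sequence of rotations tending to 1. -/
theorem measurable_circleDeriv {g : Circle → ℂ} (h : ∀ z, ∃ d, HasCircleDerivAt g d z) :
    Measurable (circleDeriv g) := by
  have hg := continuous_of_hasCircleDerivAt h
  let u : ℕ → Circle := fun n => Circle.exp (1 / ((n : ℝ) + 1))
  have hu : Tendsto u atTop (𝓝[≠] 1) := by
    have h1 : Tendsto (fun n : ℕ => 1 / ((n : ℝ) + 1)) atTop (𝓝[≠] 0) :=
      tendsto_nhdsWithin_iff.2 ⟨tendsto_one_div_add_atTop_nhds_zero_nat,
        Eventually.of_forall fun n => by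
          have : (0 : ℝ) < 1 / ((n : ℝ) + 1) := by positivity
          exact this.ne'⟩
    have h2 := (tendsto_exp_punctured 0).comp h1
    rwa [Circle.exp_zero] at h2
  refine measurable_of_tendsto_metrizable
    (f := fun n z => (g (z * u n) - g z) / (((z * u n : Circle) : ℂ) - z)) (fun n => ?_) ?_
  · have h1 : Measurable fun z => g (z * u n) - g z := by
      have : Continuous fun z => g (z * u n) - g z := by fun_prop
      exact this.measurable
    have h2 : Measurable fun z : Circle => ((z * u n : Circle) : ℂ) - z := by
      have : Continuous fun z : Circle => ((z * u n : Circle) : ℂ) - z := by fun_prop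
      exact this.measurable
    exact h1.div h2
  · rw [tendsto_pi_nhds]
    intro z
    have h1 : Tendsto (fun n => z * u n) atTop (𝓝[≠] z) := by
      refine tendsto_nhdsWithin_iff.2 ⟨?_, ?_⟩
      · simpa using (tendsto_nhdsWithin_iff.1 hu).1.const_mul z
      · filter_upwards [(tendsto_nhdsWithin_iff.1 hu).2] with n hn hz
        exact hn (mul_eq_left.1 (Set.mem_singleton_iff.1 hz))
    exact Tendsto.comp (hasCircleDerivAt_circleDeriv (h z)) h1

theorem exists_norm_le_of_continuous {g : Circle → ℂ} (hg : Continuous g) :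
    ∃ C : ℝ, ∀ z, ‖g z‖ ≤ C := by
  obtain ⟨C, hC⟩ := isCompact_univ.exists_bound_of_continuousOn (f := g) hg.continuousOn
  exact ⟨C, fun z => hC z (Set.mem_univ z)⟩

theorem integrable_of_bounded {g : Circle → ℂ} (hg : Measurable g) {C : ℝ}
    (hC : ∀ z, ‖g z‖ ≤ C) : Integrable g arcMeasure :=
  Integrable.of_bound hg.aestronglyMeasurable C (ae_of_all _ hC)

/-- This is ∫ g'(z) dz = 0, since dz = 2πi z dτ. The fundamental theorem of calculus holds for a
derivative that exists everywhere and is integrable. -/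
theorem integral_deriv_mul_eq_zero {g d : Circle → ℂ} (h : ∀ z, HasCircleDerivAt g (d z) z)
    (hd : Measurable d) {C : ℝ} (hC : ∀ z, ‖d z‖ ≤ C) :
    ∫ z : Circle, d z * z ∂arcMeasure = 0 := by
  have hdm : Measurable fun t : ℝ => d (Circle.exp t) := hd.comp (by fun_prop)
  have hm : Measurable fun t : ℝ => d (Circle.exp t) * (Circle.exp t * Complex.I) :=
    hdm.mul (by
      have : Continuous fun t : ℝ => ((Circle.exp t : Circle) : ℂ) * Complex.I := by fun_prop
      exact this.measurable)
  have hz : Measurable fun z : Circle => (z : ℂ) :=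
    (show Continuous fun z : Circle => (z : ℂ) by fun_prop).measurable
  have hint : IntervalIntegrable (fun t : ℝ => d (Circle.exp t) * (Circle.exp t * Complex.I))
      volume 0 (2 * Real.pi) := by
    refine (intervalIntegrable_const (c := C)).mono_fun hm.aestronglyMeasurable
      (ae_of_all _ fun t => ?_)
    simpa [Circle.norm_coe] using (hC _).trans (le_abs_self C)
  have h1 := intervalIntegral.integral_eq_sub_of_hasDerivAt (a := 0) (b := 2 * Real.pi)
    (fun t _ => (h (Circle.exp t)).hasDerivAt_comp_exp) hint
  rw [Circle.exp_two_pi, Circle.exp_zero, sub_self] at h1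
  have h2 : ∀ t : ℝ, d (Circle.exp t) * (Circle.exp t * Complex.I) =
      (d (Circle.exp t) * Circle.exp t) * Complex.I := fun t => by ring
  simp only [h2, intervalIntegral.integral_mul_const, mul_eq_zero, Complex.I_ne_zero,
    or_false] at h1
  have h3 := integral_arcMeasure (f := fun z => d z * (z : ℂ)) (hd.mul hz).aestronglyMeasurable
  rw [h3, h1, smul_zero]

/-! ### Fourier coefficients -/

theorem Integrable.mul_zpow {g : Circle → ℂ} (hg : Integrable g arcMeasure) (k : ℤ) :
    Integrable (fun z : Circle => g z * (z : ℂ) ^ k) arcMeasure :=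
  hg.mul_bdd (c := 1) (continuous_zpow_circle k).aestronglyMeasurable
    (ae_of_all _ fun z => (norm_zpow_circle z k).le)

/-- Integrate the derivative of g(z) z^(-k). The index drops by one because the derivative is taken
in z, not in the angle. -/
theorem fourierCoefficient_circleDeriv {g : Circle → ℂ} (h : ∀ z, ∃ d, HasCircleDerivAt g d z)
    {C : ℝ} (hC : ∀ z, ‖circleDeriv g z‖ ≤ C) (k : ℤ) :
    fourierCoefficient (circleDeriv g) (k - 1) = k * fourierCoefficient g k := by
  have hg := continuous_of_hasCircleDerivAt h
  obtain ⟨C', hC'⟩ := exists_norm_le_of_continuous hg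
  have hdm := measurable_circleDeriv h
  have hpow : ∀ z : Circle, HasCircleDerivAt (fun w : Circle => (w : ℂ) ^ (-k))
      (((-k : ℤ) : ℂ) * (z : ℂ) ^ (-k - 1)) z := fun z =>
    HasDerivAt.hasCircleDerivAt (g := fun x : ℂ => x ^ (-k))
      (hasDerivAt_zpow (-k) _ (Or.inl (Circle.coe_ne_zero z)))
  have hprod : ∀ z : Circle, HasCircleDerivAt (fun w => g w * (w : ℂ) ^ (-k))
      (circleDeriv g z * (z : ℂ) ^ (-k) + g z * (((-k : ℤ) : ℂ) * (z : ℂ) ^ (-k - 1))) z :=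
    fun z => (hasCircleDerivAt_circleDeriv (h z)).mul (hpow z)
  have hm : Measurable fun z : Circle => circleDeriv g z * (z : ℂ) ^ (-k) +
      g z * (((-k : ℤ) : ℂ) * (z : ℂ) ^ (-k - 1)) :=
    (hdm.mul (continuous_zpow_circle _).measurable).add
      (hg.measurable.mul ((continuous_zpow_circle _).measurable.const_mul _))
  have hb : ∀ z : Circle, ‖circleDeriv g z * (z : ℂ) ^ (-k) +
      g z * (((-k : ℤ) : ℂ) * (z : ℂ) ^ (-k - 1))‖ ≤ C + C' * ‖((-k : ℤ) : ℂ)‖ := by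
    intro z
    refine (norm_add_le _ _).trans ?_
    rw [norm_mul, norm_mul, norm_mul, norm_zpow_circle, norm_zpow_circle, mul_one, mul_one]
    exact add_le_add (hC z) (mul_le_mul_of_nonneg_right (hC' z) (norm_nonneg _))
  have h0 := integral_deriv_mul_eq_zero hprod hm hb
  have e : ∀ z : Circle, (circleDeriv g z * (z : ℂ) ^ (-k) +
      g z * (((-k : ℤ) : ℂ) * (z : ℂ) ^ (-k - 1))) * z =
      circleDeriv g z * (z : ℂ) ^ (-(k - 1)) - k * (g z * (z : ℂ) ^ (-k)) := by
    intro z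
    have hz := Circle.coe_ne_zero z
    rw [show -(k - 1) = -k + 1 by ring, zpow_add_one₀ hz, zpow_sub_one₀ hz]
    push_cast
    field_simp
    ring
  simp only [e] at h0
  rw [integral_sub (Integrable.mul_zpow (integrable_of_bounded hdm hC) _)
    ((Integrable.mul_zpow (integrable_of_continuous hg) _).const_mul _), integral_const_mul,
    sub_eq_zero] at h0
  exact h0

theorem summable_sq_fourierCoefficient {g : Circle → ℂ} (hg : Measurable g) {C : ℝ}
    (hC : ∀ z, ‖g z‖ ≤ C) : Summable fun k => ‖fourierCoefficient g k‖ ^ 2 := by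
  have hpi : (0 : ℝ) < 2 * Real.pi := by positivity
  have hm : Measurable fun t : ℝ => g (Circle.exp t) := hg.comp (by fun_prop)
  have hL2 : MemLp (fun t : ℝ => g (Circle.exp t)) 2
      (volume.restrict (Set.Ioc 0 (2 * Real.pi))) :=
    MemLp.of_bound hm.aestronglyMeasurable C (ae_of_all _ fun t => hC _)
  refine (hasSum_sq_fourierCoeffOn hpi hL2).summable.congr fun k => ?_
  have h3 := integral_arcMeasure (f := fun z => g z * (z : ℂ) ^ (-k))
    (hg.mul (continuous_zpow_circle _).measurable).aestronglyMeasurable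
  rw [fourierCoefficient, h3, fourierCoeffOn_eq_integral]
  congr 2
  simp only [sub_zero, one_div]
  congr 1
  refine intervalIntegral.integral_congr fun t _ => ?_
  have hpi' : (Real.pi : ℂ) ≠ 0 := by exact_mod_cast Real.pi_ne_zero
  simp only [fourier_coe_apply, smul_eq_mul, Circle.coe_exp, ← Complex.exp_int_mul]
  rw [mul_comm]
  congr 2
  push_cast
  rw [sub_zero]
  field_simp

/-! ### Uniqueness of Fourier coefficients -/

/-- Integration against g is a continuous functional on the continuous functions, and it vanishes on
the trigonometric monomials, whose span is dense. -/
theorem integral_mul_eq_zero_of_fourierCoefficient {g : Circle → ℂ}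
    (hg : Integrable g arcMeasure) (h : ∀ k, fourierCoefficient g k = 0) (u : Circle → ℂ)
    (hu : Continuous u) : ∫ z, u z * g z ∂arcMeasure = 0 := by
  have : Fact (0 < 2 * Real.pi) := ⟨by positivity⟩
  let H : AddCircle (2 * Real.pi) ≃ₜ Circle := AddCircle.homeomorphCircle'
  have hint : ∀ v : C(AddCircle (2 * Real.pi), ℂ),
      Integrable (fun z => v (H.symm z) * g z) arcMeasure := fun v =>
    hg.bdd_mul (c := ‖v‖) (v.continuous.comp H.symm.continuous).aestronglyMeasurable
      (ae_of_all _ fun z => v.norm_coe_le_norm _)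
  let Λ : C(AddCircle (2 * Real.pi), ℂ) →L[ℂ] ℂ := LinearMap.mkContinuous
    { toFun := fun v => ∫ z, v (H.symm z) * g z ∂arcMeasure
      map_add' := fun v w => by
        simp only [ContinuousMap.add_apply, add_mul]
        exact integral_add (hint v) (hint w)
      map_smul' := fun c v => by
        simp only [ContinuousMap.smul_apply, smul_eq_mul, mul_assoc, RingHom.id_apply]
        exact integral_const_mul _ _ } (∫ z, ‖g z‖ ∂arcMeasure) (fun v => by
      rw [mul_comm (∫ z, ‖g z‖ ∂arcMeasure), ← integral_const_mul]
      refine norm_integral_le_of_norm_le (hg.norm.const_mul _) (ae_of_all _ fun z => ?_)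
      rw [norm_mul]
      gcongr
      exact v.norm_coe_le_norm _)
  have hspan : (Submodule.span ℂ (Set.range <| @fourier (2 * Real.pi))).topologicalClosure ≤
      LinearMap.ker (Λ : C(AddCircle (2 * Real.pi), ℂ) →ₗ[ℂ] ℂ) := by
    refine Submodule.topologicalClosure_minimal _ (Submodule.span_le.2 ?_) Λ.isClosed_ker
    rintro _ ⟨k, rfl⟩
    have := h (-k)
    change ∫ z, fourier k (H.symm z) * g z ∂arcMeasure = 0
    rw [fourierCoefficient, neg_neg] at this
    rw [← this]
    refine integral_congr_ae (ae_of_all _ fun z => ?_)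
    obtain ⟨x, rfl⟩ := H.surjective z
    have hx : AddCircle.toCircle x = H x := by
      induction x using QuotientAddGroup.induction_on with
      | H t =>
        rw [AddCircle.toCircle_apply_mk, div_self (by positivity), one_mul]
        rfl
    simp only [H.symm_apply_apply, fourier_apply, AddCircle.toCircle_zsmul]
    rw [mul_comm, Circle.coe_zpow, hx]
  rw [span_fourier_closure_eq_top] at hspan
  have := hspan (Submodule.mem_top (x := (⟨fun x => u (H x), hu.comp H.continuous⟩ :
    C(AddCircle (2 * Real.pi), ℂ))))
  change ∫ z, u (H (H.symm z)) * g z ∂arcMeasure = 0 at this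
  simpa using this

open scoped Manifold in
theorem ae_eq_of_fourierCoefficient_eq {f g : Circle → ℂ} (hf : Integrable f arcMeasure)
    (hg : Integrable g arcMeasure) (h : ∀ k, fourierCoefficient f k = fourierCoefficient g k) :
    f =ᵐ[arcMeasure] g := by
  have h0 : ∀ k, fourierCoefficient (f - g) k = 0 := by
    intro k
    have := h k
    unfold fourierCoefficient at this ⊢
    simp only [Pi.sub_apply, sub_mul]
    rw [integral_sub (Integrable.mul_zpow hf _) (Integrable.mul_zpow hg _), this, sub_self]
  have := ae_eq_zero_of_integral_contMDiff_smul_eq_zero (𝓡 1) (hf.sub hg).locallyIntegrable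
    (fun u hu _ => by
      simpa using integral_mul_eq_zero_of_fourierCoefficient (hf.sub hg) h0 (fun z => (u z : ℂ))
        (Complex.continuous_ofReal.comp hu.continuous))
  filter_upwards [this] with z hz
  exact sub_eq_zero.1 hz

instance isOpenPosMeasure_arcMeasure : arcMeasure.IsOpenPosMeasure := by
  refine ⟨fun U hU hne h0 => ?_⟩
  have hexp : Continuous fun t : ℝ => Circle.exp t := by fun_prop
  have h1 : (volume.restrict (Set.Ioc 0 (2 * Real.pi)))
      ((fun t : ℝ => Circle.exp t) ⁻¹' U) = 0 := by
    rw [arcMeasure, Measure.smul_apply, Measure.map_apply hexp.measurable hU.measurableSet,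
      smul_eq_mul, mul_eq_zero] at h0
    exact h0.resolve_left (ENNReal.inv_ne_zero.2 ENNReal.ofReal_ne_top)
  have hV : IsOpen ((fun t : ℝ => Circle.exp t) ⁻¹' U) := hU.preimage hexp
  rw [Measure.restrict_apply hV.measurableSet] at h1
  have h2 : volume (((fun t : ℝ => Circle.exp t) ⁻¹' U) ∩ Set.Ioo 0 (2 * Real.pi)) = 0 :=
    measure_mono_null (Set.inter_subset_inter_right _ Set.Ioo_subset_Ioc_self) h1
  have h3 := (hV.inter isOpen_Ioo).eq_empty_of_measure_zero h2
  obtain ⟨z, hz⟩ := hne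
  have hpi := Real.pi_pos
  obtain ⟨t, ht, rfl⟩ : ∃ t ∈ Set.Ioc 0 (2 * Real.pi), Circle.exp t = z := by
    obtain ⟨t, ht, hzt⟩ := Circle.periodic_exp.exists_mem_Ioc (by positivity) (Complex.arg z) 0
    rw [zero_add] at ht
    exact ⟨t, ht, by rw [← hzt, Circle.exp_arg]⟩
  -- The parameter t may be the endpoint 2π, so an interior point of the interval is sought to its
  -- left.
  have h5 : ∀ᶠ s in 𝓝[<] t, s ∈ ((fun t : ℝ => Circle.exp t) ⁻¹' U) ∩ Set.Ioo 0 (2 * Real.pi) := by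
    filter_upwards [self_mem_nhdsWithin, nhdsWithin_le_nhds (hV.mem_nhds hz),
      nhdsWithin_le_nhds (Ioi_mem_nhds ht.1)] with s hs hsU hs0
    exact ⟨hsU, hs0, lt_of_lt_of_le hs ht.2⟩
  obtain ⟨s, hs⟩ := h5.exists
  rw [h3] at hs
  exact hs

theorem eq_of_fourierCoefficient_eq {f g : Circle → ℂ} (hf : Continuous f) (hg : Continuous g)
    (h : ∀ k, fourierCoefficient f k = fourierCoefficient g k) : f = g :=
  Continuous.ae_eq_iff_eq arcMeasure hf hg |>.1
    (ae_eq_of_fourierCoefficient_eq (integrable_of_continuous hf) (integrable_of_continuous hg) h)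

theorem hasSum_fourierCoefficient {κ : Type*} [Countable κ] {f : κ → Circle → ℂ} {F : Circle → ℂ}
    {B : κ → ℝ} (hf : ∀ i, Continuous (f i)) (hB : Summable B) (hfB : ∀ i z, ‖f i z‖ ≤ B i)
    (hF : ∀ z, HasSum (fun i => f i z) (F z)) (k : ℤ) :
    HasSum (fun i => fourierCoefficient (f i) k) (fourierCoefficient F k) := by
  refine hasSum_integral_of_dominated_convergence (fun i _ => B i)
    (fun i => ((hf i).mul (continuous_zpow_circle _)).aestronglyMeasurable)
    (fun i => ae_of_all _ fun z => ?_) (ae_of_all _ fun _ => hB) (integrable_const _)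
    (ae_of_all _ fun z => (hF z).mul_right _)
  rw [norm_mul, norm_zpow_circle, mul_one]
  exact hfB i z

theorem fourierCoefficient_const_mul_zpow (c : ℂ) (e k : ℤ) :
    fourierCoefficient (fun z => c * (z : ℂ) ^ e) k = if e = k then c else 0 := by
  unfold fourierCoefficient
  have : ∀ z : Circle, c * (z : ℂ) ^ e * (z : ℂ) ^ (-k) = c * (z : ℂ) ^ (e - k) := fun z => by
    rw [mul_assoc, ← zpow_add₀ (Circle.coe_ne_zero z), sub_eq_add_neg]
  simp only [this]
  rw [integral_const_mul, integral_zpow]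
  simp [sub_eq_zero]

theorem fourierCoefficient_of_hasSum {c : ℤ → ℂ} {F : Circle → ℂ} (hc : Summable fun k => ‖c k‖)
    (hF : ∀ z : Circle, HasSum (fun k => c k * (z : ℂ) ^ k) (F z)) (k : ℤ) :
    fourierCoefficient F k = c k := by
  have h1 := hasSum_fourierCoefficient (f := fun (k : ℤ) (z : Circle) => c k * (z : ℂ) ^ k)
    (fun k => (continuous_zpow_circle k).const_mul _) hc
    (fun k z => by rw [norm_mul, norm_zpow_circle, mul_one]) hF k
  simp only [fourierCoefficient_const_mul_zpow] at h1
  refine h1.unique ?_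
  convert hasSum_ite_eq k (c k) using 2 with b
  grind

theorem hasSum_fourier_series {f : Circle → ℂ} (hf : Continuous f)
    (hs : Summable fun k => ‖fourierCoefficient f k‖) (z : Circle) :
    HasSum (fun k : ℤ => fourierCoefficient f k * (z : ℂ) ^ k) (f z) := by
  have hn : ∀ (k : ℤ) (z : Circle), ‖fourierCoefficient f k * (z : ℂ) ^ k‖ ≤
      ‖fourierCoefficient f k‖ := fun k z => by rw [norm_mul, norm_zpow_circle, mul_one]
  have hsum : ∀ z : Circle, Summable fun k : ℤ => fourierCoefficient f k * (z : ℂ) ^ k :=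
    fun z => Summable.of_norm_bounded hs fun k => hn k z
  have hc : ∀ k : ℤ, Continuous fun z : Circle => fourierCoefficient f k * (z : ℂ) ^ k :=
    fun k => (continuous_zpow_circle k).const_mul _
  have e : f = fun z : Circle => ∑' k : ℤ, fourierCoefficient f k * (z : ℂ) ^ k := by
    exact eq_of_fourierCoefficient_eq hf (continuous_tsum hc hs hn) fun k =>
      (fourierCoefficient_of_hasSum hs (fun z => (hsum z).hasSum) k).symm
  have := (hsum z).hasSum
  rwa [← congrFun e z] at this

/-! ### Fourier coefficients of differentiable functions -/

theorem continuous_iterCircleDeriv {n : ℕ} {f : Circle → ℂ} (hf : f ∈ DiffClass n) {j : ℕ}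
    (hj : j < n) : Continuous (iterCircleDeriv j f) :=
  continuous_of_hasCircleDerivAt (hf j hj)

theorem circleDeriv_mem_diffClass {n : ℕ} {f : Circle → ℂ} (hf : f ∈ DiffClass (n + 1)) :
    circleDeriv f ∈ DiffClass n := fun k hk => hf (k + 1) (by omega)

theorem summable_sq_weighted_fourierCoefficient (n : ℕ) : ∀ {f : Circle → ℂ}, Measurable f →
    f ∈ DiffClass n → (∃ C : ℝ, ∀ z, ‖iterCircleDeriv n f z‖ ≤ C) →
    Summable fun k : ℤ => ((|(k : ℝ)| + 1) ^ n * ‖fourierCoefficient f k‖) ^ 2 := by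
  induction n with
  | zero =>
    rintro f hf - ⟨C, hC⟩
    simpa using summable_sq_fourierCoefficient hf hC
  | succ n ih =>
    rintro f hf hfD ⟨C, hC⟩
    have h0 : ∀ z, ∃ d, HasCircleDerivAt f d z := hfD 0 (by omega)
    have hb : ∃ C : ℝ, ∀ z, ‖circleDeriv f z‖ ≤ C := by
      rcases n.eq_zero_or_pos with rfl | hn
      · exact ⟨C, hC⟩
      · exact exists_norm_le_of_continuous (continuous_iterCircleDeriv hfD (j := 1) (by omega))
    obtain ⟨C', hC'⟩ := hb
    have h1 := ih (measurable_circleDeriv h0) (circleDeriv_mem_diffClass hfD) ⟨C, hC⟩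
    -- Each of the n + 1 weight factors loses at most 2 when |k| + 1 is compared with |k - 1| + 1 or
    -- with |k|; squaring gives 4^(n+1). The correction `h3` restores k = 0, which differentiation
    -- annihilates.
    have h2 := ((Equiv.subRight (1 : ℤ)).summable_iff.2 h1).mul_left (4 ^ (n + 1))
    have h3 : Summable fun k : ℤ => if k = 0 then ‖fourierCoefficient f 0‖ ^ 2 else 0 :=
      (hasSum_ite_eq (0 : ℤ) (‖fourierCoefficient f 0‖ ^ 2)).summable
    refine Summable.of_nonneg_of_le (fun k => by positivity) (fun k => ?_) (h2.add h3)
    simp only [Function.comp, Equiv.subRight_apply]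
    rw [fourierCoefficient_circleDeriv h0 hC', norm_mul, Complex.norm_intCast]
    split_ifs with hk
    · subst hk
      simp
    · rw [add_zero, show (4 : ℝ) ^ (n + 1) = (2 ^ (n + 1)) ^ 2 by
        rw [← pow_mul, mul_comm (n + 1), pow_mul]; norm_num, ← mul_pow]
      refine pow_le_pow_left₀ (by positivity) ?_ 2
      have hk1 : (1 : ℝ) ≤ |(k : ℝ)| := by exact_mod_cast Int.one_le_abs hk
      have a1 : |(k : ℝ)| + 1 ≤ 2 * |(k : ℝ)| := by linarith
      have a2 : |(k : ℝ)| + 1 ≤ 2 * (|((k - 1 : ℤ) : ℝ)| + 1) := by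
        push_cast
        have := abs_sub_abs_le_abs_sub (k : ℝ) 1
        rw [abs_one] at this
        linarith [abs_nonneg ((k : ℝ) - 1)]
      calc (|(k : ℝ)| + 1) ^ (n + 1) * ‖fourierCoefficient f k‖
          = (|(k : ℝ)| + 1) ^ n * (|(k : ℝ)| + 1) * ‖fourierCoefficient f k‖ := by ring
        _ ≤ (2 * (|((k - 1 : ℤ) : ℝ)| + 1)) ^ n * (2 * |(k : ℝ)|) *
            ‖fourierCoefficient f k‖ := by gcongr
        _ = _ := by rw [mul_pow]; ring

/-- One order of differentiability is traded for passing from ℓ² to ℓ¹, through ab ≤ a² + b² with b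
= (|k| + 1)^(-1). -/
theorem summable_weighted_fourierCoefficient {n : ℕ} {f : Circle → ℂ}
    (hf : f ∈ DiffClass (n + 1)) (hb : ∃ C : ℝ, ∀ z, ‖iterCircleDeriv (n + 1) f z‖ ≤ C) :
    Summable fun k : ℤ => ‖fourierCoefficient f k‖ * (|(k : ℝ)| + 1) ^ n := by
  have h1 := summable_sq_weighted_fourierCoefficient (n + 1)
    (continuous_iterCircleDeriv hf (j := 0) (by omega)).measurable hf hb
  have h2 : Summable fun k : ℤ => (|(k : ℝ)| + 1)⁻¹ ^ 2 := by
    have h3 : Summable fun n : ℕ => ((n : ℝ) + 1)⁻¹ ^ 2 := by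
      refine ((summable_nat_add_iff 1).2
        (Real.summable_one_div_nat_pow.2 one_lt_two)).congr fun n => ?_
      push_cast
      rw [one_div, inv_pow]
    refine Summable.of_nat_of_neg ?_ ?_ <;> simpa using h3
  refine Summable.of_nonneg_of_le (fun k => by positivity) (fun k => ?_) (h1.add h2)
  simp only [iterCircleDeriv, Function.iterate_zero, id]
  have hk : (0 : ℝ) < |(k : ℝ)| + 1 := by positivity
  have e : ‖fourierCoefficient f k‖ * (|(k : ℝ)| + 1) ^ n =
      ((|(k : ℝ)| + 1) ^ (n + 1) * ‖fourierCoefficient f k‖) * (|(k : ℝ)| + 1)⁻¹ := by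
    rw [pow_succ]
    field_simp
  rw [e]
  nlinarith [sq_nonneg ((|(k : ℝ)| + 1) ^ (n + 1) * ‖fourierCoefficient f k‖ -
    (|(k : ℝ)| + 1)⁻¹), sq_nonneg ((|(k : ℝ)| + 1) ^ (n + 1) * ‖fourierCoefficient f k‖),
    sq_nonneg (|(k : ℝ)| + 1)⁻¹]

theorem newClass_subset_fClass {n : ℕ} {f : Circle → ℂ} (hf : f ∈ NewClass (n + 1)) :
    f ∈ FClass n := by
  obtain ⟨hD, hb, -⟩ := hf
  have hs := summable_weighted_fourierCoefficient hD hb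
  refine ⟨⟨fun k hk => hD k (by omega), continuous_iterCircleDeriv hD (by omega)⟩,
    hasSum_fourier_series (continuous_iterCircleDeriv hD (j := 0) (by omega)) ?_, ?_⟩
  · refine Summable.of_nonneg_of_le (fun k => norm_nonneg _) (fun k => ?_) hs
    exact le_mul_of_one_le_right (norm_nonneg _)
      (one_le_pow₀ (by linarith [abs_nonneg (k : ℝ)]))
  · refine Summable.of_nonneg_of_le (fun k => by positivity) (fun k => ?_) hs
    rw [mul_comm]
    gcongr
    linarith

theorem newClass_succ_subset {n k : ℕ} (hk : k ≤ n) : NewClass (n + 1) ⊆ NewClass k := by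
  intro f hf
  obtain ⟨hD, hb, -⟩ := hf
  have hs := summable_weighted_fourierCoefficient hD hb
  have h1 : ∀ j : ℤ, 1 ≤ |(j : ℝ)| + 1 := fun j => by linarith [abs_nonneg (j : ℝ)]
  refine mem_newClass_of_summable (fourierCoefficient f) ?_
    (hasSum_fourier_series (continuous_iterCircleDeriv hD (j := 0) (by omega)) ?_)
  · refine Summable.of_nonneg_of_le (fun j => by positivity) (fun j => ?_) hs
    gcongr
    exact h1 j
  · refine Summable.of_nonneg_of_le (fun k => norm_nonneg _) (fun k => ?_) hs
    exact le_mul_of_one_le_right (norm_nonneg _) (one_le_pow₀ (h1 k))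

/-! ### Dyadic blocks of trigonometric polynomials -/

theorem tsum_int_eq_sum_natCast {f : ℤ → ℂ} {N : ℕ} (hf : ∀ k, k < 0 ∨ (N : ℤ) < k → f k = 0) :
    ∑' k, f k = ∑ d ∈ Finset.range (N + 1), f d := by
  rw [tsum_eq_sum (s := (Finset.range (N + 1)).map Nat.castEmbedding), Finset.sum_map]
  · rfl
  · intro k hk
    refine hf k ?_
    by_contra! h
    refine hk (Finset.mem_map.2 ⟨k.toNat, Finset.mem_range.2 (by omega), ?_⟩)
    simp [h.1]

theorem tsum_int_eq_sum_negSucc {f : ℤ → ℂ} {N : ℕ} (hf : ∀ k, 0 ≤ k ∨ k < -(N : ℤ) → f k = 0) :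
    ∑' k, f k = ∑ q ∈ Finset.range (N + 1), f (Int.negSucc q) := by
  rw [tsum_eq_sum (s := (Finset.range (N + 1)).map
    ⟨Int.negSucc, fun a b h => Int.negSucc.inj h⟩), Finset.sum_map]
  · rfl
  · intro k hk
    refine hf k ?_
    by_contra! h
    refine hk (Finset.mem_map.2 ⟨(-k - 1).toNat, Finset.mem_range.2 (by omega), ?_⟩)
    change Int.negSucc _ = k
    rw [Int.negSucc_eq]
    omega

/-- The constant in the estimate of the divided differences of a dyadic block. -/
noncomputable def blockConstant (n s : ℕ) : ℝ := (n * (2 ^ (s + 2) + 1) + 1) * 4 ^ n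

/-- For the block m = s + 1 + r, one has N + 1 = 2^(m+1) + 1 ≤ 4 · 2^m, so the factor 2^(nm) of the
Besov norm absorbs the growth, and the constant is independent of r. -/
theorem block_bound_le {n s r j : ℕ} (hj : j ≤ n) {S : ℝ} (hS : 0 ≤ S) :
    ((j : ℝ) * ((2 ^ (s + 2) : ℕ) + 1) + 1) * ((2 ^ (s + r + 2) : ℕ) + 1) ^ j *
      (S / 2 ^ (n * (s + 1 + r))) ≤ blockConstant n s * S := by
  have h1 : (((2 ^ (s + r + 2) : ℕ) : ℝ) + 1) ^ j ≤ 4 ^ n * 2 ^ (n * (s + 1 + r)) := by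
    have h2 : (1 : ℝ) ≤ 2 ^ (s + r) := one_le_pow₀ one_le_two
    calc (((2 ^ (s + r + 2) : ℕ) : ℝ) + 1) ^ j
        ≤ (4 * 2 ^ (s + 1 + r)) ^ j := by
          push_cast
          gcongr
          rw [show s + 1 + r = s + r + 1 by ring, pow_add, pow_add _ (s + r) 1]
          linarith
      _ ≤ (4 * 2 ^ (s + 1 + r)) ^ n := by
          refine pow_le_pow_right₀ ?_ hj
          have : (1 : ℝ) ≤ 2 ^ (s + 1 + r) := one_le_pow₀ one_le_two
          linarith
      _ = 4 ^ n * 2 ^ (n * (s + 1 + r)) := by rw [mul_pow, ← pow_mul, mul_comm n]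
  calc ((j : ℝ) * ((2 ^ (s + 2) : ℕ) + 1) + 1) * ((2 ^ (s + r + 2) : ℕ) + 1) ^ j *
        (S / 2 ^ (n * (s + 1 + r)))
      ≤ ((n : ℝ) * ((2 ^ (s + 2) : ℕ) + 1) + 1) * (4 ^ n * 2 ^ (n * (s + 1 + r))) *
        (S / 2 ^ (n * (s + 1 + r))) := by gcongr
    _ = blockConstant n s * S := by
        unfold blockConstant
        push_cast
        field_simp

theorem norm_le_div_of_norm_mul_le {x : ℂ} {p : ℕ} {S : ℝ} (h : ‖(2 : ℂ) ^ p * x‖ ≤ S) :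
    ‖x‖ ≤ S / 2 ^ p := by
  rw [le_div_iff₀ (by positivity), mul_comm]
  simpa using h

section Blocks

variable {n s r j : ℕ} {c : ℤ → ℂ} {T : Circle → ℂ} {S : ℝ}

theorem separatedBound_dyadic_pos (hs : 2 * n ≤ 2 ^ s) (hj : j ≤ n)
    (hc : ∀ k : ℤ, k < 2 ^ (s + r) ∨ 2 ^ (s + r + 2) < k → c k = 0)
    (hT : ∀ z : Circle, HasSum (fun k => c k * (z : ℂ) ^ k) (T z))
    (hS : ∀ z, ‖(2 : ℂ) ^ (n * (s + 1 + r)) * T z‖ ≤ S) :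
    SeparatedBound (j + 1) (fun z => ∑' k, c k * monomialDivDiff k j z)
      (blockConstant n s * S) := by
  have hS0 : 0 ≤ S := (norm_nonneg _).trans (hS 1)
  have hjr : j * 2 ^ r + j ≤ 2 ^ (s + r) := by
    have h1 : 1 ≤ 2 ^ r := Nat.one_le_two_pow
    calc j * 2 ^ r + j ≤ n * 2 ^ r + n * 2 ^ r :=
          add_le_add (Nat.mul_le_mul_right _ hj) (hj.trans (Nat.le_mul_of_pos_right _ h1))
      _ = 2 * n * 2 ^ r := by ring
      _ ≤ 2 ^ s * 2 ^ r := Nat.mul_le_mul_right _ hs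
      _ = 2 ^ (s + r) := (pow_add _ _ _).symm
  have hpos : (0 : ℤ) < 2 ^ (s + r) := by positivity
  have hz : ∀ k : ℤ, k < 0 ∨ ((2 ^ (s + r + 2) : ℕ) : ℤ) < k → c k = 0 := by
    intro k hk
    push_cast at hk
    exact hc k (hk.imp (fun h => h.trans hpos) id)
  have hN : ∀ d : ℕ, 2 ^ (s + r + 2) < d → c d = 0 := fun d hd =>
    hc d (Or.inr (by exact_mod_cast hd))
  have hA : ∀ d : ℕ, d < 2 ^ (s + r) → c d = 0 := fun d hd => hc d (Or.inl (by exact_mod_cast hd))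
  -- With L = 2^r and N = Q L, the ratio Q = 2^(s+2) does not depend on the block. The shift by j
  -- comes from z^k having divided difference h_(k-j); since 2n ≤ 2^s, there remains room for j L ≤
  -- 2^(s+r) - j.
  have hblock := separatedBound_block (L := 2 ^ r) (Q := 2 ^ (s + 2)) (by positivity) j
    (N := 2 ^ (s + r + 2)) (A := 2 ^ (s + r) - j) (c := fun d => c ((d + j : ℕ) : ℤ))
    (M := S / 2 ^ (n * (s + 1 + r))) (by omega) (by rw [← pow_add]; ring_nf; rfl)
    (fun d hd => hN _ (by omega)) (fun d hd => hA _ (by omega)) (fun z => by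
      have h1 := norm_le_div_of_norm_mul_le (hS z)
      rw [← (hT z).tsum_eq, tsum_int_eq_sum_natCast (N := 2 ^ (s + r + 2))
        (fun k hk => by rw [hz k hk, zero_mul]), sum_range_shift (e := j)
        (fun d hd => by rw [hN d hd, zero_mul])
        (fun d hd => by rw [hA d (by omega), zero_mul])] at h1
      have e : ∑ i ∈ Finset.range (2 ^ (s + r + 2) + 1), c ((i + j : ℕ) : ℤ) *
          (z : ℂ) ^ ((i + j : ℕ) : ℤ) = (z : ℂ) ^ j *
          ∑ i ∈ Finset.range (2 ^ (s + r + 2) + 1), c ((i + j : ℕ) : ℤ) * (z : ℂ) ^ i := by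
        rw [Finset.mul_sum]
        refine Finset.sum_congr rfl fun i _ => ?_
        rw [zpow_natCast, pow_add]
        ring
      rwa [e, norm_mul, norm_pow, Circle.norm_coe, one_pow, one_mul] at h1)
  have e : (fun z : Fin (j + 1) → Circle => ∑' k, c k * monomialDivDiff k j z) = fun z =>
      ∑ d ∈ Finset.range (2 ^ (s + r + 2) + 1),
        c ((d + j : ℕ) : ℤ) * completeHomogeneous (coordList z) d := by
    funext z
    rw [tsum_int_eq_sum_natCast (N := 2 ^ (s + r + 2))
      (fun k hk => by rw [hz k hk, zero_mul]), sum_range_shift (e := j)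
      (fun d hd => by rw [hN d hd, zero_mul])
      (fun d hd => by rw [hA d (by omega), zero_mul])]
    refine Finset.sum_congr rfl fun d _ => ?_
    rw [monomialDivDiff_natCast, if_pos (by omega), Nat.add_sub_cancel]
  rw [e]
  exact hblock.mono (block_bound_le hj hS0)

theorem separatedBound_dyadic_neg (hn : 1 ≤ n) (hs : 2 * n ≤ 2 ^ s) (hj : j ≤ n)
    (hc : ∀ k : ℤ, -2 ^ (s + r) < k ∨ k < -2 ^ (s + r + 2) → c k = 0)
    (hT : ∀ z : Circle, HasSum (fun k => c k * (z : ℂ) ^ k) (T z))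
    (hS : ∀ z, ‖(2 : ℂ) ^ (n * (s + 1 + r)) * T z‖ ≤ S) :
    SeparatedBound (j + 1) (fun z => ∑' k, c k * monomialDivDiff k j z)
      (blockConstant n s * S) := by
  have hS0 : 0 ≤ S := (norm_nonneg _).trans (hS 1)
  have hjr : j * 2 ^ r + 1 ≤ 2 ^ (s + r) := by
    have h1 : 1 ≤ 2 ^ r := Nat.one_le_two_pow
    calc j * 2 ^ r + 1 ≤ n * 2 ^ r + n * 2 ^ r :=
          add_le_add (Nat.mul_le_mul_right _ hj) (hn.trans (Nat.le_mul_of_pos_right _ h1))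
      _ = 2 * n * 2 ^ r := by ring
      _ ≤ 2 ^ s * 2 ^ r := Nat.mul_le_mul_right _ hs
      _ = 2 ^ (s + r) := (pow_add _ _ _).symm
  have hpos : (0 : ℤ) < 2 ^ (s + r) := by positivity
  have hz : ∀ k : ℤ, 0 ≤ k ∨ k < -((2 ^ (s + r + 2) : ℕ) : ℤ) → c k = 0 := by
    intro k hk
    push_cast at hk
    exact hc k (hk.imp (fun h => by linarith) id)
  have hN : ∀ q : ℕ, 2 ^ (s + r + 2) < q → c (Int.negSucc q) = 0 := fun q hq =>
    hc _ (Or.inr (by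
      zify at hq
      rw [Int.negSucc_eq]
      linarith))
  have hA : ∀ q : ℕ, q < 2 ^ (s + r) - 1 → c (Int.negSucc q) = 0 := fun q hq =>
    hc _ (Or.inl (by
      have h : q + 1 < 2 ^ (s + r) := by omega
      zify at h
      rw [Int.negSucc_eq]
      linarith))
  -- Here k = -(q + 1), so frequencies |k| ≥ 2^(s+r) become q ≥ 2^(s+r) - 1. The supremum bound is
  -- read off at z⁻¹, where T is z times a polynomial in z.
  have hblock := separatedBound_block (L := 2 ^ r) (Q := 2 ^ (s + 2)) (by positivity) j
    (N := 2 ^ (s + r + 2)) (A := 2 ^ (s + r) - 1) (c := fun q => c (Int.negSucc q))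
    (M := S / 2 ^ (n * (s + 1 + r))) (by omega) (by rw [← pow_add]; ring_nf; rfl) hN hA
    (fun z => by
      have h1 := norm_le_div_of_norm_mul_le (hS z⁻¹)
      rw [← (hT z⁻¹).tsum_eq, tsum_int_eq_sum_negSucc (N := 2 ^ (s + r + 2))
        (fun k hk => by rw [hz k hk, zero_mul])] at h1
      have e : ∑ q ∈ Finset.range (2 ^ (s + r + 2) + 1), c (Int.negSucc q) *
          ((z⁻¹ : Circle) : ℂ) ^ (Int.negSucc q) = z *
          ∑ q ∈ Finset.range (2 ^ (s + r + 2) + 1), c (Int.negSucc q) * (z : ℂ) ^ q := by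
        rw [Finset.mul_sum]
        refine Finset.sum_congr rfl fun q _ => ?_
        rw [zpow_negSucc, Circle.coe_inv, inv_pow, inv_inv, pow_succ]
        ring
      rwa [e, norm_mul, Circle.norm_coe, one_mul] at h1)
  have e : (fun z : Fin (j + 1) → Circle => ∑' k, c k * monomialDivDiff k j z) = fun z =>
      (-1) ^ j * ((∏ i, (z i : ℂ)⁻¹) * ∑ q ∈ Finset.range (2 ^ (s + r + 2) + 1),
        c (Int.negSucc q) * completeHomogeneous (coordList fun i => (z i)⁻¹) q) := by
    funext z
    rw [tsum_int_eq_sum_negSucc (N := 2 ^ (s + r + 2))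
      (fun k hk => by rw [hz k hk, zero_mul]), Finset.mul_sum, Finset.mul_sum]
    refine Finset.sum_congr rfl fun q _ => ?_
    rw [monomialDivDiff_negSucc]
    ring
  rw [e]
  have := (hblock.comp_inv.mul_prod (fun z => (z : ℂ)⁻¹) (by
    simpa using continuous_zpow_circle (-1)) (fun z => by simp [Circle.norm_coe])).smul ((-1) ^ j)
  refine this.mono ?_
  simp only [norm_pow, norm_neg, norm_one, one_pow, one_mul]
  exact block_bound_le hj hS0

end Blocks

/-! ### The dyadic cutoff -/

namespace IsDyadicCutoff

variable {w : ℝ → ℝ}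

/-- The endpoints are included because the set where w ≠ 0 is open, hence contained in the open
interval. -/
theorem eq_zero (hw : IsDyadicCutoff w) {x : ℝ} (hx : x ≤ 1 / 2 ∨ 2 ≤ x) : w x = 0 := by
  by_contra h
  have h1 : IsOpen (Function.support w) := hw.smooth.continuous.isOpen_support
  have h2 : Function.support w ⊆ interior (Set.Icc (1 / 2) 2) :=
    interior_maximal ((subset_tsupport w).trans hw.supp) h1
  rw [interior_Icc] at h2
  have := h2 (Function.mem_support.2 h)
  rcases hx with hx | hx
  · exact absurd this.1 (not_lt.2 hx)
  · exact absurd this.2 (not_lt.2 hx)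

/-- For 2^(q+1) ≤ k < 2^(q+2) only the terms m = q and m = q + 1 can be nonzero, and the dyadic
relation at k / 2^(q+1) makes them add up to 1. For k = 1 every term vanishes, because w(1/2) = 0.
-/
theorem hasSum_dyadic (hw : IsDyadicCutoff w) (k : ℤ) :
    HasSum (fun m : ℕ => w ((k : ℝ) / 2 ^ (m + 1))) (if 2 ≤ k then 1 else 0) := by
  split_ifs with hk
  · obtain ⟨p, rfl⟩ := Int.eq_ofNat_of_zero_le (by omega : 0 ≤ k)
    have hp : 2 ≤ p := by exact_mod_cast hk
    obtain ⟨q, hq⟩ : ∃ q, Nat.log 2 p = q + 1 :=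
      ⟨Nat.log 2 p - 1, by have := Nat.log_pos one_lt_two hp; omega⟩
    have h1 : 2 ^ (q + 1) ≤ p := hq ▸ Nat.pow_log_le_self 2 (by omega)
    have h2 : p < 2 ^ (q + 2) := by
      have := Nat.lt_pow_succ_log_self one_lt_two p
      rwa [hq] at this
    have h1' : (2 : ℝ) ^ (q + 1) ≤ p := by exact_mod_cast h1
    have h2' : (p : ℝ) ≤ 2 ^ (q + 2) := by exact_mod_cast h2.le
    have hd := hw.dyadic ((p : ℝ) / 2 ^ (q + 1))
      ⟨(one_le_div (by positivity)).2 h1', (div_le_iff₀ (by positivity)).2 (by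
        rw [← pow_succ']; exact h2')⟩
    have hs : ∑ m ∈ {q, q + 1}, w ((p : ℝ) / 2 ^ (m + 1)) = 1 := by
      rw [Finset.sum_pair (by omega), hd, div_div, ← pow_succ]
      ring
    simp only [Int.cast_natCast]
    rw [← hs]
    refine hasSum_sum_of_ne_finset_zero fun m hm => hw.eq_zero ?_
    simp only [Finset.mem_insert, Finset.mem_singleton, not_or] at hm
    rcases lt_or_ge m q with h | h
    · right
      rw [le_div_iff₀ (by positivity), ← pow_succ']
      exact (pow_le_pow_right₀ one_le_two (by omega)).trans h1'
    · left
      rw [div_le_iff₀ (by positivity)]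
      have : (2 : ℝ) ^ (q + 2) * 2 ≤ 2 ^ (m + 1) := by
        rw [← pow_succ]
        exact pow_le_pow_right₀ one_le_two (by omega)
      linarith
  · have h0 : ∀ m : ℕ, w ((k : ℝ) / 2 ^ (m + 1)) = 0 := fun m => hw.eq_zero (Or.inl (by
      have hk1 : (k : ℝ) ≤ 1 := by exact_mod_cast (by omega : k ≤ 1)
      rw [div_le_iff₀ (by positivity)]
      have : (1 : ℝ) ≤ 2 ^ m := one_le_pow₀ one_le_two
      rw [pow_succ]
      linarith))
    simpa only [h0] using hasSum_zero

end IsDyadicCutoff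

/-- The Fourier coefficients of `W_m`. -/
noncomputable def dyadicCoeff (w : ℝ → ℝ) (m : ℕ) (k : ℤ) : ℂ :=
  if m = 0 then (if |k| ≤ 1 then 1 else 0) else w ((k : ℝ) / 2 ^ m)

theorem dyadicCoeff_eq_zero {w : ℝ → ℝ} (hw : IsDyadicCutoff w) {m : ℕ} {k : ℤ}
    (hk : 2 ^ (m + 1) < |k|) : dyadicCoeff w m k = 0 := by
  unfold dyadicCoeff
  split_ifs with h1 h2
  · subst h1
    norm_num at hk
    omega
  · rfl
  · rw [hw.eq_zero, Complex.ofReal_zero]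
    have hk' : (2 : ℝ) ^ (m + 1) < |(k : ℝ)| := by exact_mod_cast hk
    rcases lt_abs.1 hk' with h | h
    · right
      rw [le_div_iff₀ (by positivity), ← pow_succ']
      exact h.le
    · left
      have : (k : ℝ) / 2 ^ m ≤ 0 := by
        apply div_nonpos_of_nonpos_of_nonneg _ (by positivity)
        have : (0 : ℝ) < 2 ^ (m + 1) := by positivity
        linarith
      linarith

theorem dyadicPoly_eq_sum {w : ℝ → ℝ} (hw : IsDyadicCutoff w) (m : ℕ) (z : Circle) :
    dyadicPoly w m z = ∑ k ∈ Finset.Icc (-2 ^ (m + 1)) (2 ^ (m + 1) : ℤ),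
      dyadicCoeff w m k * (z : ℂ) ^ k := by
  by_cases hm : m = 0
  · subst hm
    have e : Finset.Icc (-2 ^ (0 + 1)) (2 ^ (0 + 1) : ℤ) = {-2, -1, 0, 1, 2} := by decide
    rw [e]
    simp [dyadicPoly, dyadicCoeff, ← Circle.coe_inv_eq_conj, add_assoc]
  · simp only [dyadicPoly, if_neg hm]
    rw [tsum_eq_sum (s := Finset.Icc (-2 ^ (m + 1)) (2 ^ (m + 1) : ℤ))]
    · simp [dyadicCoeff, if_neg hm]
    · intro k hk
      have h := dyadicCoeff_eq_zero hw (m := m) (k := k) (by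
        by_contra! h
        exact hk (Finset.mem_Icc.2 (abs_le.1 h)))
      rw [dyadicCoeff, if_neg hm] at h
      rw [h, zero_mul]

theorem dyadicPolySharp_eq_sum {w : ℝ → ℝ} (hw : IsDyadicCutoff w) (m : ℕ) (z : Circle) :
    dyadicPolySharp w m z = ∑ k ∈ Finset.Icc (-2 ^ (m + 1)) (2 ^ (m + 1) : ℤ),
      dyadicCoeff w m (-k) * (z : ℂ) ^ k := by
  rw [dyadicPolySharp, dyadicPoly_eq_sum hw, map_sum]
  refine Finset.sum_equiv (Equiv.neg ℤ) (fun k => ?_) (fun k _ => ?_)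
  · simp only [Finset.mem_Icc, Equiv.neg_apply]
    omega
  · rw [map_mul, map_zpow₀, ← Circle.coe_inv_eq_conj, Circle.coe_inv, inv_zpow', Equiv.neg_apply,
      neg_neg]
    congr 1
    unfold dyadicCoeff
    split_ifs <;> simp

theorem circleConv_eq_sum {φ W : Circle → ℂ} (hφ : Integrable φ arcMeasure) (s : Finset ℤ)
    (b : ℤ → ℂ) (hW : ∀ z, W z = ∑ k ∈ s, b k * (z : ℂ) ^ k) (z : Circle) :
    circleConv φ W z = ∑ k ∈ s, b k * fourierCoefficient φ k * (z : ℂ) ^ k := by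
  have h1 : ∀ ζ : Circle, φ ζ * W (ζ⁻¹ * z) =
      ∑ k ∈ s, b k * (z : ℂ) ^ k * (φ ζ * (ζ : ℂ) ^ (-k)) := by
    intro ζ
    rw [hW, Finset.mul_sum]
    refine Finset.sum_congr rfl fun k _ => ?_
    rw [Circle.coe_mul, Circle.coe_inv, mul_zpow, inv_zpow']
    ring
  unfold circleConv
  simp only [h1]
  rw [integral_finsetSum _ fun k _ => (Integrable.mul_zpow hφ _).const_mul _]
  refine Finset.sum_congr rfl fun k _ => ?_
  rw [integral_const_mul, fourierCoefficient]
  ring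

theorem norm_le_toReal_supNorm {g : Circle → ℂ} (h : supNorm g ≠ ⊤) (z : Circle) :
    ‖g z‖ ≤ (supNorm g).toReal := by
  rw [← toReal_enorm]
  exact ENNReal.toReal_mono h (le_iSup (fun z => ‖g z‖ₑ) z)

/-- The block estimate needs m large compared with n; the finitely many earlier blocks may have any
bound. -/
theorem exists_summable_bound {P : ℕ → ℝ → Prop} {S : ℕ → ℝ} (hS : Summable S) (m₀ : ℕ)
    (h1 : ∀ m, ∃ b, P m b) (h2 : ∀ m, m₀ ≤ m → P m (S m)) :
    ∃ B : ℕ → ℝ, Summable B ∧ ∀ m, P m (B m) := by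
  choose b hb using h1
  refine ⟨fun m => if m < m₀ then b m else S m, ?_, fun m => ?_⟩
  · rw [← summable_nat_add_iff m₀] at hS ⊢
    simpa using hS
  · dsimp only
    split_ifs with h
    · exact hb m
    · exact h2 m (not_lt.1 h)

/-! ### Besov functions -/

theorem exists_newClass_fourierCoefficient_eq {w : ℝ → ℝ} (hw : IsDyadicCutoff w) {n : ℕ}
    (hn : 1 ≤ n) {φ : Circle → ℂ} (hφ : φ ∈ BesovClass w n) :
    ∃ f ∈ NewClass n, ∀ k, fourierCoefficient f k = fourierCoefficient φ k := by
  obtain ⟨hi, hp, hm⟩ := hφ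
  let c : ℕ ⊕ ℕ → ℤ → ℂ := Sum.elim (fun m k => dyadicCoeff w m k * fourierCoefficient φ k)
    (fun m k => dyadicCoeff w (m + 1) (-k) * fourierCoefficient φ k)
  let T : ℕ ⊕ ℕ → Circle → ℂ := Sum.elim (fun m => circleConv φ (dyadicPoly w m))
    (fun m => circleConv φ (dyadicPolySharp w (m + 1)))
  let D : ℕ ⊕ ℕ → (j : ℕ) → (Fin (j + 1) → Circle) → ℂ :=
    fun i j z => ∑' k, c i k * monomialDivDiff k j z
  have hsupp : ∀ i, ∃ N : ℤ, ∀ k ∉ Finset.Icc (-N) N, c i k = 0 := by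
    rintro (m | m)
    · refine ⟨2 ^ (m + 1), fun k hk => ?_⟩
      have : (2 : ℤ) ^ (m + 1) < |k| := by
        by_contra! h
        exact hk (Finset.mem_Icc.2 (abs_le.1 h))
      simp [c, dyadicCoeff_eq_zero hw this]
    · refine ⟨2 ^ (m + 1 + 1), fun k hk => ?_⟩
      have : (2 : ℤ) ^ (m + 1 + 1) < |-k| := by
        rw [abs_neg]
        by_contra! h
        exact hk (Finset.mem_Icc.2 (abs_le.1 h))
      simp [c, dyadicCoeff_eq_zero hw this]
  have hsum : ∀ i (g : ℤ → ℝ), Summable fun k => ‖c i k‖ * g k := by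
    intro i g
    obtain ⟨N, hN⟩ := hsupp i
    exact summable_of_ne_finset_zero (s := Finset.Icc (-N) N) fun k hk => by simp [hN k hk]
  have hT : ∀ i (z : Circle), HasSum (fun k => c i k * (z : ℂ) ^ k) (T i z) := by
    rintro (m | m) z
    · simp only [c, T, Sum.elim_inl]
      rw [circleConv_eq_sum hi _ _ (dyadicPoly_eq_sum hw m)]
      refine hasSum_sum_of_ne_finset_zero fun k hk => ?_
      rw [dyadicCoeff_eq_zero hw, zero_mul, zero_mul]
      by_contra! h
      exact hk (Finset.mem_Icc.2 (abs_le.1 h))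
    · simp only [c, T, Sum.elim_inr]
      rw [circleConv_eq_sum hi _ (fun k => dyadicCoeff w (m + 1) (-k))
        (dyadicPolySharp_eq_sum hw (m + 1))]
      refine hasSum_sum_of_ne_finset_zero fun k hk => ?_
      rw [dyadicCoeff_eq_zero hw, zero_mul, zero_mul]
      rw [abs_neg]
      by_contra! h
      exact hk (Finset.mem_Icc.2 (abs_le.1 h))
  have hD : ∀ i, IsDivDiffSystem n (T i) (D i) := fun i =>
    isDivDiffSystem_series (fun k => k) (c i) (hsum i _) (hT i)
  have hex : ∀ i, ∃ b, ∀ j ≤ n, SeparatedBound (j + 1) (D i j) b := fun i =>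
    ⟨_, fun j hj => separatedBound_series hj (fun k => k) (c i) (hsum i _)⟩
  -- This s depends on n alone; the refined estimate is used for the blocks of level m ≥ s + 1.
  obtain ⟨s, hs⟩ : ∃ s, 2 * n ≤ 2 ^ s := ⟨2 * n, Nat.lt_two_pow_self.le⟩
  have hzero : ∀ {r : ℕ} {k : ℤ}, k < 2 ^ (s + r) ∨ 2 ^ (s + r + 2) < k →
      dyadicCoeff w (s + 1 + r) k = 0 := by
    intro r k hk
    rw [dyadicCoeff, if_neg (by omega), hw.eq_zero, Complex.ofReal_zero]
    refine hk.imp (fun h => ?_) (fun h => ?_)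
    · have h' : (k : ℝ) < 2 ^ (s + r) := by exact_mod_cast h
      rw [div_le_iff₀ (by positivity), show s + 1 + r = s + r + 1 by ring, pow_succ]
      linarith
    · have h' : (2 : ℝ) ^ (s + r + 2) < k := by exact_mod_cast h
      rw [le_div_iff₀ (by positivity), ← pow_succ', show s + 1 + r + 1 = s + r + 2 by ring]
      exact h'.le
  -- summable bounds for the blocks with positive frequencies
  obtain ⟨B₁, hB₁, hb₁⟩ : ∃ B : ℕ → ℝ, Summable B ∧
      ∀ m, ∀ j ≤ n, SeparatedBound (j + 1) (D (Sum.inl m) j) (B m) := by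
    have hfin := fun m => ENNReal.ne_top_of_tsum_ne_top hp.ne m
    refine exists_summable_bound ((ENNReal.summable_toReal hp.ne).mul_left (blockConstant n s))
      (s + 1) (fun m => hex _) fun m hm j hj => ?_
    obtain ⟨r, rfl⟩ := Nat.exists_eq_add_of_le hm
    refine separatedBound_dyadic_pos hs hj (r := r) (fun k hk => ?_) (hT _)
      fun z => norm_le_toReal_supNorm (hfin (s + 1 + r)) z
    simp [c, hzero hk]
  -- The index m stands for W_(m+1)^♯, so the threshold is s instead of s + 1.
  obtain ⟨B₂, hB₂, hb₂⟩ : ∃ B : ℕ → ℝ, Summable B ∧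
      ∀ m, ∀ j ≤ n, SeparatedBound (j + 1) (D (Sum.inr m) j) (B m) := by
    have hfin := fun m => ENNReal.ne_top_of_tsum_ne_top hm.ne m
    refine exists_summable_bound ((ENNReal.summable_toReal hm.ne).mul_left (blockConstant n s))
      s (fun m => hex _) fun m hm j hj => ?_
    obtain ⟨r, rfl⟩ := Nat.exists_eq_add_of_le hm
    refine separatedBound_dyadic_neg hn hs hj (r := r) (fun k hk => ?_) (hT _) fun z => ?_
    · have : dyadicCoeff w (s + r + 1) (-k) = 0 := by
        rw [show s + r + 1 = s + 1 + r by ring]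
        exact hzero (hk.imp (fun h => by linarith) (fun h => by linarith))
      simp [c, this]
    · rw [show s + 1 + r = s + r + 1 by ring]
      exact norm_le_toReal_supNorm (hfin (s + r)) z
  let B : ℕ ⊕ ℕ → ℝ := Sum.elim B₁ B₂
  have hB : Summable B :=
    (HasSum.sum (f := B) hB₁.hasSum hB₂.hasSum).summable
  have hb : ∀ i, ∀ j ≤ n, SeparatedBound (j + 1) (D i j) (B i) := by
    rintro (m | m)
    exacts [hb₁ m, hb₂ m]
  have hTB : ∀ i z, ‖T i z‖ ≤ B i := fun i z => by
    have := (hb i 0 (Nat.zero_le _)).norm_le fun _ => z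
    rwa [(hD i).zero] at this
  have hTs : ∀ z, HasSum (fun i => T i z) (∑' i, T i z) := fun z =>
    (Summable.of_norm_bounded hB fun i => hTB i z).hasSum
  have hsys := IsDivDiffSystem.hasSum hD hB (fun i j hj z => (hb i j hj).norm_le z) hTs
  refine ⟨fun z => ∑' i, T i z, hsys.mem_newClass (SeparatedBound.hasSum
    (fun i => hb i n le_rfl) hB fun z => Summable.hasSum (Summable.of_norm_bounded hB
      fun i => (hb i n le_rfl).norm_le z)), fun k => ?_⟩
  have hTc : ∀ i, Continuous (T i) := fun i => by
    have h := continuous_iterCircleDeriv (hD i).mem_diffClass (j := 0) (by omega)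
    exact h
  have h1 := hasSum_fourierCoefficient hTc hB hTB hTs k
  have h2 : ∀ i, fourierCoefficient (T i) k = c i k := fun i =>
    fourierCoefficient_of_hasSum (by simpa using hsum i fun _ => 1) (hT i) k
  simp only [h2] at h1
  refine h1.unique ?_
  -- the dyadic partition of unity
  have hco : ∀ k : ℤ, HasSum (fun m => dyadicCoeff w (m + 1) k) (if 2 ≤ k then 1 else 0) := by
    intro k
    have h := Complex.hasSum_ofReal.2 (hw.hasSum_dyadic k)
    rw [apply_ite Complex.ofReal, Complex.ofReal_one, Complex.ofReal_zero] at h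
    exact h
  -- The unconjugated blocks, with W_0 among them, account for all k ≥ -1, and the conjugated ones
  -- for k ≤ -2, so each frequency is counted exactly once.
  have hw1 : HasSum (fun m => c (Sum.inl m) k)
      ((if -1 ≤ k then 1 else 0) * fourierCoefficient φ k) := by
    refine HasSum.mul_right _ ?_
    have h := (hasSum_nat_add_iff (f := fun m => dyadicCoeff w m k) 1).1 (hco k)
    have e : (if 2 ≤ k then 1 else 0 : ℂ) + ∑ m ∈ Finset.range 1, dyadicCoeff w m k =
        if -1 ≤ k then 1 else 0 := by
      rw [Finset.sum_range_one, dyadicCoeff, if_pos rfl]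
      have : |k| ≤ 1 ↔ -1 ≤ k ∧ k ≤ 1 := abs_le
      split_ifs <;> first | omega | simp
    rwa [e] at h
  have hw2 : HasSum (fun m => c (Sum.inr m) k)
      ((if -1 ≤ k then 0 else 1) * fourierCoefficient φ k) := by
    refine HasSum.mul_right _ ?_
    have e : (if 2 ≤ -k then 1 else 0 : ℂ) = if -1 ≤ k then 0 else 1 := by
      split_ifs <;> first | omega | simp
    rw [← e]
    exact hco (-k)
  have e : (if -1 ≤ k then 1 else 0) * fourierCoefficient φ k +
      (if -1 ≤ k then 0 else 1) * fourierCoefficient φ k = fourierCoefficient φ k := by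
    split_ifs <;> ring
  have h3 := HasSum.sum (f := fun i => c i k) hw1 hw2
  rwa [e] at h3

end CircleFunctionClasses

/-! ### The three inclusions assembled -/

theorem mainTheorem7 (n : ℕ) (hn : 1 ≤ n) :
    (∀ w : ℝ → ℝ, CircleFunctionClasses.IsDyadicCutoff w →
      ((∀ φ ∈ CircleFunctionClasses.BesovClass w n,
        ∃ f ∈ CircleFunctionClasses.NewClass n,
          f =ᵐ[CircleFunctionClasses.arcMeasure] φ) ∧
      {φ ∈ CircleFunctionClasses.BesovClass w n | Continuous φ} ⊆
        CircleFunctionClasses.NewClass n)) ∧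
    CircleFunctionClasses.NewClass n ⊆ CircleFunctionClasses.FClass (n - 1) ∧
    CircleFunctionClasses.NewClass n =
      ⋂ k ∈ Set.Icc 1 n, CircleFunctionClasses.NewClass k := by
  have hcont : ∀ f ∈ CircleFunctionClasses.NewClass n, Continuous f := fun f hf =>
    CircleFunctionClasses.continuous_iterCircleDeriv hf.1 (j := 0) (by omega)
  obtain ⟨p, rfl⟩ := Nat.exists_eq_add_of_le' hn
  refine ⟨fun w hw => ⟨fun φ hφ => ?_, fun φ hφ => ?_⟩,
    fun f hf => CircleFunctionClasses.newClass_subset_fClass hf, ?_⟩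
  · obtain ⟨f, hf, hk⟩ :=
      CircleFunctionClasses.exists_newClass_fourierCoefficient_eq hw hn hφ
    exact ⟨f, hf, CircleFunctionClasses.ae_eq_of_fourierCoefficient_eq
      (CircleFunctionClasses.integrable_of_continuous (hcont f hf)) hφ.1 hk⟩
  · obtain ⟨f, hf, hk⟩ :=
      CircleFunctionClasses.exists_newClass_fourierCoefficient_eq hw hn hφ.1
    rwa [← CircleFunctionClasses.eq_of_fourierCoefficient_eq (hcont f hf) hφ.2 hk]
  · refine Set.Subset.antisymm (fun f hf => Set.mem_iInter₂.2 fun k hk => ?_)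
      (fun f hf => Set.mem_iInter₂.1 hf (p + 1) ⟨hn, le_rfl⟩)
    rcases hk.2.lt_or_eq with h | rfl
    · exact CircleFunctionClasses.newClass_succ_subset (Nat.lt_succ_iff.1 h) hf
    · exact hf
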